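/- Conventions. Let $A$ be an artin algebra, i.e. an algebra over a commutative artinian ring $R$ that is finitely generated as an $R$-module. Let $\operatorname{mod} A$ be the category of finitely generated right $A$-modules and $\operatorname{proj} A$ its full subcategory of projective modules. $A$ is *representation-finite* if $\operatorname{mod}A$ has only finitely many indecomposable objects up to isomorphism. In that case an *Auslander algebra* of $A$ is $B=\operatorname{End}_A(M)$, where $M\in\operatorname{mod}A$ is any additive generator, i.e. every object of $\operatorname{mod}A$ is a direct summand of some $M^k$ (for instance the direct sum of one representative of each isomorphism class of indecomposable objects). $A$ is a *Nakayama algebra* if every indecomposable object of $\operatorname{mod}A$ is uniserial. A two-sided ideal $H$ of a ring $B$ is *heredity* if $H^2=H$, $H$ is projective as a right $B$-module, and $HJ(B)H=0$, where $J(B)$ is the Jacobson radical. A chain $B=H_0>H_1>\cdots>H_n=0$ of idempotent two-sided ideals is a *heredity chain* if each $H_i/H_{i+1}$ is a heredity ideal of $B/H_{i+1}$ ($0\le i<n$). It is *right-strongly* (resp. *left-strongly*) *heredity* if, for $0\le i<n$, $H_i$ is projective as a right (resp. left) $B$-module and $(H_i/H_{i+1})\,J(B/H_{i+1})\,(H_i/H_{i+1})=0$.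 $B$ is *strongly quasi-hereditary* if it has a heredity chain that is both right-strongly and left-strongly heredity. Subcategories of an additive category $\mathcal C$ are assumed full and closed under isomorphisms, finite direct sums and direct summands. A subcategory $\mathcal C'$ is *rejective* if the inclusion $\mathcal C'\hookrightarrow\mathcal C$ has a right adjoint whose counit is a monomorphism at every object and a left adjoint whose unit is an epimorphism at every object. It is *cosemisimple* if the Jacobson radical of the factor category $\mathcal C/[\mathcal C']$ is zero, where $[\mathcal C']$ is the ideal of morphisms that factor through an object of $\mathcal C'$. A *rejective chain* of $\mathcal C$ is a chain of subcategories $\mathcal C=\mathcal C_0\supseteq\mathcal C_1\supseteq\cdots\supseteq\mathcal C_n=0$ such that $\mathcal C_i$ is a cosemisimple rejective subcategory of $\mathcal C_{i-1}$ for $1\le i\le n$. **Theorem 1.4.** Let $A$ be a representation-finite artin algebra and $B$ an Auslander algebra of $A$. The following conditions are equivalent: 1. $B$ is strongly quasi-hereditary; 2. $\operatorname{proj} B$ has a rejective chain; 3. $\operatorname{mod} A$ has a rejective chain; 4. $A$ is a Nakayama algebra. -/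

import Mathlib

open CategoryTheory

universe v u

namespace StronglyQH

/-! ### Heredity chains and strongly quasi-hereditary rings

Left modules over the opposite ring `Rᵐᵒᵖ` are right `R`-modules. -/

section HeredityChains

variable {R : Type*} [Ring R]

/-- The product ideal `H * H` is `H`. -/
def IsIdempotentIdeal (H : TwoSidedIdeal R) : Prop :=
  H.asIdeal * H.asIdeal = H.asIdeal

/-- `H * J(R) * H = 0`, where `J(R)` is the Jacobson radical of `R`. -/
def KillsRadical (H : TwoSidedIdeal R) : Prop :=
  ∀ x ∈ H, ∀ j ∈ Ring.jacobson R, ∀ y ∈ H, x * j * y = 0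

/-- Heredity ideals: idempotent, projective as a right module, and `H * J(R) * H = 0`. -/
structure IsHeredityIdeal (H : TwoSidedIdeal R) : Prop where
  idempotent : IsIdempotentIdeal H
  projective : Module.Projective Rᵐᵒᵖ H
  killsRadical : KillsRadical H

/-- The ideal `H / H'` of the factor ring `R / H'` (used for `H' ≤ H`). -/
def quotIdeal (H H' : TwoSidedIdeal R) : TwoSidedIdeal (R ⧸ H'.asIdeal) :=
  H.map (Ideal.Quotient.mk H'.asIdeal)

/-- A chain `R = H 0 > H 1 > ⋯ > H n = 0` of idempotent two-sided ideals. The values `H i` with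
`i > n` are irrelevant. -/
structure IsIdempotentIdealChain (n : ℕ) (H : ℕ → TwoSidedIdeal R) : Prop where
  zero : H 0 = ⊤
  last : H n = ⊥
  strict : ∀ i < n, H (i + 1) < H i
  idempotent : ∀ i ≤ n, IsIdempotentIdeal (H i)

/-- Heredity chains. -/
structure IsHeredityChain (n : ℕ) (H : ℕ → TwoSidedIdeal R) : Prop extends
    IsIdempotentIdealChain n H where
  heredity : ∀ i < n, IsHeredityIdeal (quotIdeal (H i) (H (i + 1)))

/-- Right-strongly heredity chains. -/
structure IsRightStronglyHeredityChain (n : ℕ) (H : ℕ → TwoSidedIdeal R) : Prop extends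
    IsIdempotentIdealChain n H where
  projective : ∀ i < n, Module.Projective Rᵐᵒᵖ (H i)
  killsRadical : ∀ i < n, KillsRadical (quotIdeal (H i) (H (i + 1)))

/-- Left-strongly heredity chains. -/
structure IsLeftStronglyHeredityChain (n : ℕ) (H : ℕ → TwoSidedIdeal R) : Prop extends
    IsIdempotentIdealChain n H where
  projective : ∀ i < n, Module.Projective R (H i)
  killsRadical : ∀ i < n, KillsRadical (quotIdeal (H i) (H (i + 1)))

variable (R) in
/-- `R` has a heredity chain that is right-strongly and left-strongly heredity. -/
def IsStronglyQuasiHereditary : Prop :=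
  ∃ (n : ℕ) (H : ℕ → TwoSidedIdeal R), IsHeredityChain n H ∧
    IsRightStronglyHeredityChain n H ∧ IsLeftStronglyHeredityChain n H

end HeredityChains

/-! ### Rejective chains of an additive category -/

section RejectiveChains

variable {C : Type u} [Category.{v} C]

/-- The inclusion of the full subcategory on `P` has a right adjoint with monic counit. -/
def IsRightRejective (P : ObjectProperty C) : Prop :=
  ∃ (G : C ⥤ P.FullSubcategory) (adj : P.ι ⊣ G), ∀ X : C, Mono (adj.counit.app X)

/-- The inclusion of the full subcategory on `P` has a left adjoint with epic unit. -/
def IsLeftRejective (P : ObjectProperty C) : Prop :=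
  ∃ (G : C ⥤ P.FullSubcategory) (adj : G ⊣ P.ι), ∀ X : C, Epi (adj.unit.app X)

/-- Right and left rejective. -/
def IsRejective (P : ObjectProperty C) : Prop :=
  IsRightRejective P ∧ IsLeftRejective P

/-- Membership in the ideal `[P]`: the morphism `f` factors through an object of `P`. -/
def FactorsThrough (P : ObjectProperty C) {X Y : C} (f : X ⟶ Y) : Prop :=
  ∃ (Z : C) (_ : P Z) (a : X ⟶ Z) (b : Z ⟶ Y), a ≫ b = f

variable [Preadditive C]

/-- `P` is closed under isomorphisms, finite direct sums (including the empty one) and direct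
summands. -/
structure IsAdditiveSubcategory (P : ObjectProperty C) : Prop where
  iso : ∀ {X Y : C}, (X ≅ Y) → P X → P Y
  zero : ∀ Z : C, Limits.IsZero Z → P Z
  sum_iff : ∀ {X Y : C} (b : Limits.BinaryBicone X Y), Nonempty b.IsBilimit →
    (P b.pt ↔ P X ∧ P Y)

/-- The endomorphism `t` of `X` becomes invertible in the factor category `C / [P]`. -/
def IsInvertibleMod (P : ObjectProperty C) {X : C} (t : X ⟶ X) : Prop :=
  ∃ s : X ⟶ X, FactorsThrough P (t ≫ s - 𝟙 X) ∧ FactorsThrough P (s ≫ t - 𝟙 X)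

/-- The class of `f` in the factor category `C / [P]` lies in the Jacobson radical of that
category: for every `g : Y ⟶ X`, the class of `𝟙 X - f ≫ g` is invertible. -/
def InRadicalMod (P : ObjectProperty C) {X Y : C} (f : X ⟶ Y) : Prop :=
  ∀ g : Y ⟶ X, IsInvertibleMod P (𝟙 X - f ≫ g)

/-- `P` is cosemisimple in `C`: the Jacobson radical of the factor category `C / [P]` is zero, so
that a morphism whose class is in the radical has class zero, i.e. belongs to `[P]`. -/
def IsCosemisimple (P : ObjectProperty C) : Prop :=
  ∀ {X Y : C} (f : X ⟶ Y), InRadicalMod P f → FactorsThrough P f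

/-- `C = S 0 ⊇ S 1 ⊇ ⋯ ⊇ S n = 0` is a chain of subcategories in which each `S (i + 1)`, regarded
as a subcategory of `S i`, is rejective and cosemisimple. The values `S i` with `i > n` are
irrelevant. -/
structure IsRejectiveChain (n : ℕ) (S : ℕ → ObjectProperty C) : Prop where
  zero : S 0 = ⊤
  last : ∀ X : C, S n X ↔ Limits.IsZero X
  le : ∀ i < n, S (i + 1) ≤ S i
  additive : ∀ i ≤ n, IsAdditiveSubcategory (S i)
  rejective : ∀ i < n, IsRejective ((S (i + 1)).inverseImage (S i).ι)
  cosemisimple : ∀ i < n, IsCosemisimple ((S (i + 1)).inverseImage (S i).ι)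

variable (C) in
/-- `C` has a rejective chain. -/
def HasRejectiveChain : Prop :=
  ∃ (n : ℕ) (S : ℕ → ObjectProperty C), IsRejectiveChain n S

end RejectiveChains

/-! ### Module categories, representation-finite and Nakayama algebras -/

section Modules

variable (A : Type u) [Ring A]

/-- `mod A`: finitely generated right `A`-modules. -/
abbrev ModCat : Type (u + 1) :=
  FGModuleCat.{u} Aᵐᵒᵖ

/-- `proj A`: finitely generated projective right `A`-modules. -/
abbrev ProjCat : Type (u + 1) :=
  ObjectProperty.FullSubcategory (C := ModuleCat.{u} Aᵐᵒᵖ)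
    fun P => Module.Finite Aᵐᵒᵖ P ∧ Module.Projective Aᵐᵒᵖ P

/-- A nonzero right module with no nontrivial direct sum decomposition. -/
structure IsIndecomposable (M : Type u) [AddCommGroup M] [Module Aᵐᵒᵖ M] : Prop where
  nontrivial : Nontrivial M
  eq_bot : ∀ N N' : Submodule Aᵐᵒᵖ M, IsCompl N N' → N = ⊥ ∨ N' = ⊥

/-- The submodules of `M` are totally ordered by inclusion. -/
def IsUniserial (M : Type u) [AddCommGroup M] [Module Aᵐᵒᵖ M] : Prop :=
  ∀ N N' : Submodule Aᵐᵒᵖ M, N ≤ N' ∨ N' ≤ N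

/-- There are only finitely many isomorphism classes of finitely generated indecomposable right
`A`-modules. -/
def IsRepresentationFinite : Prop :=
  ∃ (n : ℕ) (X : Fin n → ModuleCat.{u} Aᵐᵒᵖ), ∀ M : ModuleCat.{u} Aᵐᵒᵖ,
    Module.Finite Aᵐᵒᵖ M → IsIndecomposable A M → ∃ i, Nonempty (M ≅ X i)

/-- Every finitely generated indecomposable right `A`-module is uniserial. -/
def IsNakayama : Prop :=
  ∀ (M : Type u) [AddCommGroup M] [Module Aᵐᵒᵖ M],
    Module.Finite Aᵐᵒᵖ M → IsIndecomposable A M → IsUniserial A M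

/-- `M` is an additive generator of `mod A`: it is finitely generated, and `add M = mod A`, i.e.
every finitely generated right `A`-module is a direct summand of a finite direct sum of copies of
`M`. For a representation-finite `A`, a direct sum of representatives of the isomorphism classes of
the finitely generated indecomposable modules is such an `M`. -/
structure IsAdditiveGenerator (M : Type u) [AddCommGroup M] [Module Aᵐᵒᵖ M] : Prop where
  finite : Module.Finite Aᵐᵒᵖ M
  summand : ∀ (N : Type u) [AddCommGroup N] [Module Aᵐᵒᵖ N], Module.Finite Aᵐᵒᵖ N →
    ∃ (k : ℕ) (s : N →ₗ[Aᵐᵒᵖ] (Fin k → M)) (r : (Fin k → M) →ₗ[Aᵐᵒᵖ] N), r ∘ₗ s = LinearMap.id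

/-- The Auslander algebra `End_A(M)` attached to an additive generator `M` of `mod A`; the product
is composition of maps. -/
abbrev AuslanderAlgebra (M : Type u) [AddCommGroup M] [Module Aᵐᵒᵖ M] : Type u :=
  Module.End Aᵐᵒᵖ M

end Modules

end StronglyQH

/-! Write `J` for the radical of `A`. The theorem compares arbitrary chains with the filtration by
Loewy length.

If `A` is Nakayama, use the modules killed by `J ^ k` and, in `End M`, the ideals of endomorphisms
whose image is killed by `J ^ k`. The largest submodule and the largest factor module killed by `J ^
k` give the two approximations; as both are summands of powers of `M` when formed from `M`, they
also give projectivity on both sides. Cosemisimplicity and `H J H = 0` come from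
`IsNakayama.exists_retract`: between modules of Loewy length at most `k + 1`, a map whose image is
not killed by `J ^ k` is split injective on some uniserial summand, so it is not radical.

Conversely, let `S 0 ⊇ ⋯ ⊇ S n = 0` be a rejective chain of `mod A` and `X` an indecomposable object
of `S i`. By Fitting's lemma, inclusions of proper submodules of `X` and projections with nonzero
kernel are radical, so they factor through `S (i + 1)`. The classes are closed under submodules and
factor modules, hence these submodules and factors lie in `S (i + 1)`. If `X` does not, it is
uniform and its proper submodules have proper sums, and uniseriality follows by induction
(`isNakayama_of_filtration`). For a chain of ideals `H i`, the same argument runs with `IdealClass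
(H i)`; one-sided projectivity supplies the closure properties (`RightClosed.of_projective`,
`LeftClosed.of_projective`).

Finally, `Hom(M, -)` is an equivalence from `mod A` to `proj (End M)`, and rejective chains
transport along equivalences. -/

namespace StronglyQH

/-! ### Fitting's lemma and maps between uniserial modules -/

section FiniteLength

variable {A : Type u} [Ring A]

theorem isUnit_one_sub_comp_comm {S X Y : Type*} [Ring S] [AddCommGroup X] [Module S X]
    [AddCommGroup Y] [Module S Y] (f : X →ₗ[S] Y) (g : Y →ₗ[S] X)
    (h : IsUnit (1 - g ∘ₗ f : Module.End S X)) : IsUnit (1 - f ∘ₗ g : Module.End S Y) := by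
  obtain ⟨⟨u, w, huw, hwu⟩, rfl : u = _⟩ := h
  have h1 : ∀ x, w x - g (f (w x)) = x := fun x => LinearMap.congr_fun huw x
  have h2 : ∀ x, w (x - g (f x)) = x := fun x => LinearMap.congr_fun hwu x
  refine ⟨⟨1 - f ∘ₗ g, 1 + f ∘ₗ w ∘ₗ g, ?_, ?_⟩, rfl⟩
  · ext y
    have := congrArg f (h1 (g y))
    simp only [map_sub] at this
    simp only [Module.End.mul_apply, LinearMap.sub_apply, LinearMap.add_apply,
      Module.End.one_apply, LinearMap.comp_apply, map_add]
    rw [this, sub_add_cancel]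
  · ext y
    have := congrArg f (h2 (g y))
    simp only [map_sub] at this
    simp only [Module.End.mul_apply, LinearMap.sub_apply, LinearMap.add_apply,
      Module.End.one_apply, LinearMap.comp_apply, map_sub]
    rw [add_sub_add_comm, this, sub_add_cancel]

/-- Fitting's lemma: for large `n` the module is `ker (t ^ n) ⊕ range (t ^ n)`, so `t` is invertible
or nilpotent. -/
theorem IsIndecomposable.isUnit_one_sub [IsArtinianRing Aᵐᵒᵖ] {X : Type u}
    [AddCommGroup X] [Module Aᵐᵒᵖ X]
    [Module.Finite Aᵐᵒᵖ X] (hX : IsIndecomposable A X) {t : Module.End Aᵐᵒᵖ X}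
    (ht : ¬ IsUnit t) : IsUnit (1 - t) := by
  obtain ⟨n, hn, hn1⟩ := ((LinearMap.eventually_isCompl_ker_pow_range_pow t).and
    (Filter.eventually_ge_atTop 1)).exists
  rcases hX.eq_bot _ _ hn with h | h
  · refine absurd ?_ ht
    have hr : LinearMap.range (t ^ n) = ⊤ := by simpa [h] using hn.sup_eq_top
    have : IsUnit (t ^ n) := (Module.End.isUnit_iff _).2
      ⟨LinearMap.ker_eq_bot.1 h, LinearMap.range_eq_top.1 hr⟩
    exact (isUnit_pow_iff (by omega)).1 this
  · exact IsNilpotent.isUnit_one_sub ⟨n, LinearMap.range_eq_bot.1 h⟩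

/-- Take a minimal summand whose idempotent satisfies `Q`. A decomposition of it would split that
idempotent into two, one of which still satisfies `Q`, against minimality. This isolates the one
indecomposable summand that matters, without a full decomposition. -/
theorem exists_isIndecomposable_retract [IsArtinianRing Aᵐᵒᵖ] {X : Type u}
    [AddCommGroup X] [Module Aᵐᵒᵖ X]
    [Module.Finite Aᵐᵒᵖ X] (Q : Module.End Aᵐᵒᵖ X → Prop) (h0 : ¬ Q 0)
    (hadd : ∀ e e', Q (e + e') → Q e ∨ Q e') (h1 : Q 1) :
    ∃ (N : Submodule Aᵐᵒᵖ X) (p : X →ₗ[Aᵐᵒᵖ] N), p ∘ₗ N.subtype = LinearMap.id ∧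
      IsIndecomposable A N ∧ Q (N.subtype ∘ₗ p) := by
  let T : Set (Submodule Aᵐᵒᵖ X) :=
    {N | ∃ p : X →ₗ[Aᵐᵒᵖ] N, p ∘ₗ N.subtype = LinearMap.id ∧ Q (N.subtype ∘ₗ p)}
  have hT : T.Nonempty := ⟨⊤, LinearMap.id.codRestrict ⊤ (fun _ => trivial), rfl, h1⟩
  obtain ⟨N, ⟨p, hp, hQ⟩, hmin⟩ := WellFounded.has_min
    (wellFounded_lt : WellFounded ((· < ·) : Submodule Aᵐᵒᵖ X → _ → Prop)) T hT
  have hp' : ∀ x : N, p x = x := fun x => LinearMap.congr_fun hp x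
  have key : ∀ P P' : Submodule Aᵐᵒᵖ N, ∀ h : IsCompl P P', P' ≠ ⊥ →
      ¬ Q (N.subtype ∘ₗ Submodule.projection P P' h ∘ₗ p) := by
    intro P P' h hP' hQ'
    refine hmin (P.map N.subtype)
      ⟨(N.subtype ∘ₗ Submodule.projection P P' h ∘ₗ p).codRestrict _ fun x =>
      ⟨_, Submodule.projection_apply_mem h _, rfl⟩, ?_, hQ'⟩ ?_
    · ext ⟨_, y, hy, rfl⟩
      change ((Submodule.projection P P' h (p (y : X)) : N) : X) = y
      rw [hp', Submodule.projection_apply_of_mem_left h hy]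
    · refine lt_of_le_of_ne (Submodule.map_subtype_le _ _) fun he => hP' ?_
      have : P = ⊤ := by
        rw [eq_top_iff]
        rintro ⟨x, hx⟩ -
        rw [← he] at hx
        obtain ⟨y, hy, rfl⟩ := hx
        exact hy
      simpa [this] using h.inf_eq_bot
  refine ⟨N, p, hp, ⟨?_, ?_⟩, hQ⟩
  · by_contra hN
    rw [not_nontrivial_iff_subsingleton] at hN
    apply h0
    convert hQ
    ext x
    simp [Subsingleton.elim (p x) 0]
  · intro P P' h
    by_contra! hc
    rcases hadd (N.subtype ∘ₗ Submodule.projection P P' h ∘ₗ p)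
      (N.subtype ∘ₗ Submodule.projection P' P h.symm ∘ₗ p) (by
      convert hQ using 1
      ext x
      simpa using congrArg Subtype.val (Submodule.projection_add_projection_eq_self h (p x)))
      with h' | h'
    · exact key _ _ h hc.2 h'
    · exact key _ _ h.symm hc.1 h'

/-- A module killed by the radical is semisimple, so `N` has a complement; uniseriality makes the
two comparable. -/
theorem IsUniserial.eq_bot_or_eq_top [IsArtinianRing Aᵐᵒᵖ] {X : Type u}
    [AddCommGroup X] [Module Aᵐᵒᵖ X]
    (hX : IsUniserial A X) (hJ : ∀ a ∈ Ring.jacobson Aᵐᵒᵖ, ∀ x : X, a • x = 0)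
    (N : Submodule Aᵐᵒᵖ X) : N = ⊥ ∨ N = ⊤ := by
  have ht : Module.IsTorsionBySet Aᵐᵒᵖ X (Ring.jacobson Aᵐᵒᵖ : Set Aᵐᵒᵖ) :=
    fun x a => hJ a a.2 x
  let _ := ht.module
  have : IsSemisimpleModule Aᵐᵒᵖ X := ht.isSemisimpleModule_iff.1 inferInstance
  obtain ⟨N', h⟩ := exists_isCompl N
  rcases hX N N' with h' | h'
  · left; simpa [inf_eq_left.2 h'] using h.inf_eq_bot
  · right; simpa [sup_eq_left.2 h'] using h.sup_eq_top

theorem IsUniserial.submodule {X : Type u} [AddCommGroup X] [Module Aᵐᵒᵖ X]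
    (hX : IsUniserial A X) (N : Submodule Aᵐᵒᵖ X) : IsUniserial A N := fun P P' =>
  (hX (P.map N.subtype) (P'.map N.subtype)).imp
    (Submodule.map_le_map_iff_of_injective N.injective_subtype _ _).1
    (Submodule.map_le_map_iff_of_injective N.injective_subtype _ _).1

theorem IsUniserial.quotient {X : Type u} [AddCommGroup X] [Module Aᵐᵒᵖ X]
    (hX : IsUniserial A X) (N : Submodule Aᵐᵒᵖ X) : IsUniserial A (X ⧸ N) := fun P P' =>
  (hX (P.comap N.mkQ) (P'.comap N.mkQ)).imp
    (Submodule.comap_le_comap_iff_of_surjective N.mkQ_surjective).1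
    (Submodule.comap_le_comap_iff_of_surjective N.mkQ_surjective).1

theorem smul_top_eq_bot_of_forall {S X : Type*} [Ring S] [AddCommGroup X] [Module S X] {I : Ideal S}
    (h : ∀ a ∈ I, ∀ x : X, a • x = 0) : I • (⊤ : Submodule S X) = ⊥ :=
  eq_bot_iff.2 (Submodule.smul_le.2 fun a ha x _ => h a ha x)

/-- A map between uniserial modules of Loewy length at most `k + 1` whose image has Loewy length
`k + 1` is bijective. -/
theorem IsUniserial.bijective [IsArtinianRing Aᵐᵒᵖ] {X Y : Type u} [AddCommGroup X] [Module Aᵐᵒᵖ X]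
    [AddCommGroup Y] [Module Aᵐᵒᵖ Y] (hX : IsUniserial A X) (hY : IsUniserial A Y) (k : ℕ)
    (hXk : ∀ a ∈ Ring.jacobson Aᵐᵒᵖ ^ (k + 1), ∀ x : X, a • x = 0)
    (hYk : ∀ a ∈ Ring.jacobson Aᵐᵒᵖ ^ (k + 1), ∀ y : Y, a • y = 0) (f : X →ₗ[Aᵐᵒᵖ] Y)
    (hf : ¬ ∀ a ∈ Ring.jacobson Aᵐᵒᵖ ^ k, ∀ x, a • f x = 0) : Function.Bijective f := by
  set J := Ring.jacobson Aᵐᵒᵖ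
  constructor
  · rw [← LinearMap.ker_eq_bot]
    -- `J ^ k X` is killed by `J`, hence has no proper nonzero submodule. It is not inside the
    -- kernel, so the kernel lies strictly inside it and vanishes.
    set S : Submodule Aᵐᵒᵖ X := J ^ k • ⊤
    have hS : ¬ S ≤ LinearMap.ker f := fun h => hf fun a ha x => by
      rw [← map_smul]
      exact h (Submodule.smul_mem_smul ha trivial)
    have hle := (hX (LinearMap.ker f) S).resolve_right hS
    have hJS : ∀ a ∈ J, ∀ x : S, a • x = 0 := by
      rintro a ha ⟨x, hx⟩
      ext
      have : a • x ∈ J ^ (k + 1) • (⊤ : Submodule Aᵐᵒᵖ X) := by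
        rw [Ideal.IsTwoSided.pow_succ, Submodule.mul_smul]
        exact Submodule.smul_mem_smul ha hx
      rw [smul_top_eq_bot_of_forall hXk] at this
      exact this
    rcases (hX.submodule S).eq_bot_or_eq_top hJS ((LinearMap.ker f).submoduleOf S) with h | h
    · rw [eq_bot_iff]
      intro x hx
      have : (⟨x, hle hx⟩ : S) ∈ (LinearMap.ker f).submoduleOf S := hx
      rw [h] at this
      simpa using this
    · exact absurd (fun x hx => by
        have : (⟨x, hx⟩ : S) ∈ (LinearMap.ker f).submoduleOf S := by rw [h]; trivial
        exact this) hS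
  · rw [← LinearMap.range_eq_top]
    -- Dually, the range is not inside `J Y`, so it contains `J Y`, and its image in `Y / J Y` is
    -- everything.
    set S : Submodule Aᵐᵒᵖ Y := J • ⊤
    have hS : ¬ LinearMap.range f ≤ S := by
      intro h
      refine hf fun a ha x => ?_
      have : a • f x ∈ J ^ (k + 1) • (⊤ : Submodule Aᵐᵒᵖ Y) := by
        rw [Submodule.pow_succ, Submodule.mul_smul]
        exact Submodule.smul_mem_smul ha (h ⟨x, rfl⟩)
      rw [smul_top_eq_bot_of_forall hYk] at this
      exact this
    have hle := (hY (LinearMap.range f) S).resolve_left hS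
    have hJS : ∀ a ∈ J, ∀ y : Y ⧸ S, a • y = 0 := by
      intro a ha y
      obtain ⟨y, rfl⟩ := S.mkQ_surjective y
      rw [← map_smul]
      exact (Submodule.Quotient.mk_eq_zero _).2 (Submodule.smul_mem_smul ha trivial)
    rcases (hY.quotient S).eq_bot_or_eq_top hJS ((LinearMap.range f).map S.mkQ) with h | h
    · refine absurd (fun y hy => ?_) hS
      have : S.mkQ y ∈ (LinearMap.range f).map S.mkQ := ⟨y, hy, rfl⟩
      rw [h] at this
      simpa using this
    · rw [eq_top_iff]
      intro y _
      have : S.mkQ y ∈ (LinearMap.range f).map S.mkQ := by rw [h]; trivial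
      obtain ⟨z, hz, hzy⟩ := this
      have h2 : y - z ∈ S := by
        rw [← Submodule.Quotient.mk_eq_zero]
        simpa [sub_eq_zero] using hzy.symm
      simpa using add_mem (hle h2) hz

/-- Over a Nakayama algebra, a map between modules of Loewy length at most `k + 1` whose image has
Loewy length `k + 1` is an isomorphism between suitable indecomposable summands. -/
theorem IsNakayama.exists_retract [IsArtinianRing Aᵐᵒᵖ] (hA : IsNakayama A) {X Y : Type u}
    [AddCommGroup X] [Module Aᵐᵒᵖ X] [Module.Finite Aᵐᵒᵖ X]
    [AddCommGroup Y] [Module Aᵐᵒᵖ Y] [Module.Finite Aᵐᵒᵖ Y] (k : ℕ)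
    (hXk : ∀ a ∈ Ring.jacobson Aᵐᵒᵖ ^ (k + 1), ∀ x : X, a • x = 0)
    (hYk : ∀ a ∈ Ring.jacobson Aᵐᵒᵖ ^ (k + 1), ∀ y : Y, a • y = 0) (f : X →ₗ[Aᵐᵒᵖ] Y)
    (hf : ¬ ∀ a ∈ Ring.jacobson Aᵐᵒᵖ ^ k, ∀ x, a • f x = 0) :
    ∃ (N : Submodule Aᵐᵒᵖ X) (p : Y →ₗ[Aᵐᵒᵖ] N), (∀ x : N, p (f x) = x) ∧
      ¬ ∀ a ∈ Ring.jacobson Aᵐᵒᵖ ^ k, ∀ x : N, a • x = 0 := by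
  -- Cut down the source, then the target, to an indecomposable summand, each time keeping an image
  -- that `J ^ k` does not kill.
  obtain ⟨N, p, hp, hN, hQ⟩ := exists_isIndecomposable_retract
    (fun e : Module.End Aᵐᵒᵖ X => ¬ ∀ a ∈ Ring.jacobson Aᵐᵒᵖ ^ k, ∀ x, a • f (e x) = 0)
    (by simp) (fun e e' h => by
      by_contra! hc
      exact h fun a ha x => by simp [hc.1 a ha x, hc.2 a ha x]) hf
  obtain ⟨N', p', hp', hN', hQ'⟩ := exists_isIndecomposable_retract
    (fun e : Module.End Aᵐᵒᵖ Y => ¬ ∀ a ∈ Ring.jacobson Aᵐᵒᵖ ^ k, ∀ x : N, a • e (f x) = 0)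
    (by simp) (fun e e' h => by
      by_contra! hc
      exact h fun a ha x => by simp [hc.1 a ha x, hc.2 a ha x]) (fun h => hQ fun a ha x => by
        simpa using h a ha (p x))
  have hbij := (hA N inferInstance hN).bijective (hA N' inferInstance hN') k
    (fun a ha x => Subtype.ext (hXk a ha x)) (fun a ha x => Subtype.ext (hYk a ha x))
    (p' ∘ₗ f ∘ₗ N.subtype) (fun h => hQ' fun a ha x => by
      simpa using congrArg Subtype.val (h a ha x))
  let e := LinearEquiv.ofBijective _ hbij
  refine ⟨N, e.symm.toLinearMap ∘ₗ p', fun x => e.symm_apply_apply x, fun h => hQ ?_⟩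
  intro a ha x
  have := congrArg Subtype.val (h a ha (p x))
  simp only [Submodule.coe_smul, Submodule.coe_zero] at this
  simp [← map_smul, this]

end FiniteLength
-- A filtration criterion for Nakayama algebras
section Uniserial

variable {A : Type u} [Ring A]

theorem isIndecomposable_of_uniform {X : Type u} [AddCommGroup X] [Module Aᵐᵒᵖ X] [Nontrivial X]
    (h : ∀ U V : Submodule Aᵐᵒᵖ X, U ⊓ V = ⊥ → U = ⊥ ∨ V = ⊥) : IsIndecomposable A X :=
  ⟨inferInstance, fun _ _ hc => h _ _ hc.inf_eq_bot⟩

theorem uniform_submodule {X : Type u} [AddCommGroup X] [Module Aᵐᵒᵖ X]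
    (h : ∀ U V : Submodule Aᵐᵒᵖ X, U ⊓ V = ⊥ → U = ⊥ ∨ V = ⊥) (N : Submodule Aᵐᵒᵖ X)
    (U V : Submodule Aᵐᵒᵖ N) (hUV : U ⊓ V = ⊥) : U = ⊥ ∨ V = ⊥ := by
  have hinj := N.injective_subtype
  refine (h (U.map N.subtype) (V.map N.subtype) ?_).imp ?_ ?_
  · rw [← Submodule.map_inf _ hinj, hUV, Submodule.map_bot]
  all_goals exact fun h' => (Submodule.map_injective_of_injective hinj) (by simpa using h')

/-- A filtration of the finitely generated modules by classes `S 0 ⊇ S 1 ⊇ ⋯ ⊇ S n = 0` such that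
the indecomposable modules in `S i` outside `S (i + 1)` are uniform, have at most one maximal
submodule, and have their proper submodules in `S (i + 1)`, forces the algebra to be Nakayama. -/
theorem isNakayama_of_filtration [IsArtinianRing Aᵐᵒᵖ] (n : ℕ)
    (S : ℕ → ∀ (X : Type u) [AddCommGroup X] [Module Aᵐᵒᵖ X], Prop)
    (h0 : ∀ (X : Type u) [AddCommGroup X] [Module Aᵐᵒᵖ X] [Module.Finite Aᵐᵒᵖ X], S 0 X)
    (hn : ∀ (X : Type u) [AddCommGroup X] [Module Aᵐᵒᵖ X] [Module.Finite Aᵐᵒᵖ X], S n X →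
      Subsingleton X)
    (huniform : ∀ i < n, ∀ (X : Type u) [AddCommGroup X] [Module Aᵐᵒᵖ X] [Module.Finite Aᵐᵒᵖ X],
      IsIndecomposable A X → S i X → ∀ U V : Submodule Aᵐᵒᵖ X, U ≠ ⊥ → V ≠ ⊥ → U ⊓ V = ⊥ →
      S (i + 1) X)
    (hlocal : ∀ i < n, ∀ (X : Type u) [AddCommGroup X] [Module Aᵐᵒᵖ X] [Module.Finite Aᵐᵒᵖ X],
      IsIndecomposable A X → S i X → ∀ U V : Submodule Aᵐᵒᵖ X, U ≠ ⊤ → V ≠ ⊤ → U ⊔ V = ⊤ →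
      S (i + 1) X)
    (hproper : ∀ i < n, ∀ (X : Type u) [AddCommGroup X] [Module Aᵐᵒᵖ X] [Module.Finite Aᵐᵒᵖ X],
      IsIndecomposable A X → S i X → ∀ U : Submodule Aᵐᵒᵖ X, U ≠ ⊤ → S (i + 1) U) :
    IsNakayama A := by
  -- Induct upwards from the zero class `S n`.
  suffices H : ∀ k ≤ n, ∀ (X : Type u) [AddCommGroup X] [Module Aᵐᵒᵖ X] [Module.Finite Aᵐᵒᵖ X],
      IsIndecomposable A X → S (n - k) X → IsUniserial A X by
    intro X _ _ hf hX
    exact H n le_rfl X hX (by rw [Nat.sub_self]; exact h0 X)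
  intro k
  induction k with
  | zero =>
    intro _ X _ _ _ hX hS
    have := hn X hS
    exact absurd hX.nontrivial (not_nontrivial X)
  | succ k ih =>
    intro hk X _ _ _ hX hS
    have hi : n - (k + 1) < n := by omega
    have hi' : n - (k + 1) + 1 = n - k := by omega
    by_cases hS' : S (n - k) X
    · exact ih (by omega) X hX hS'
    have hu : ∀ U V : Submodule Aᵐᵒᵖ X, U ⊓ V = ⊥ → U = ⊥ ∨ V = ⊥ := by
      intro U V hUV
      by_contra! hc
      exact hS' (hi' ▸ huniform _ hi X hX hS U V hc.1 hc.2 hUV)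
    intro N N'
    by_cases hN : N = ⊤
    · exact Or.inr (hN ▸ le_top)
    by_cases hN' : N' = ⊤
    · exact Or.inl (hN' ▸ le_top)
    have hT : N ⊔ N' ≠ ⊤ := fun hT => hS' (hi' ▸ hlocal _ hi X hX hS N N' hN hN' hT)
    rcases subsingleton_or_nontrivial (N ⊔ N' : Submodule Aᵐᵒᵖ X) with hs | hs
    · left
      intro x hx
      have : (⟨x, (le_sup_left : N ≤ N ⊔ N') hx⟩ : (N ⊔ N' : Submodule Aᵐᵒᵖ X)) = 0 :=
        Subsingleton.elim _ _
      have hx0 : x = 0 := congrArg Subtype.val this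
      simp [hx0]
    -- Compare `N` and `N'` inside their sum: it is proper, hence in the next class, and uniform,
    -- hence indecomposable, so the induction hypothesis applies.
    · have := ih (by omega) (N ⊔ N' : Submodule Aᵐᵒᵖ X)
        (isIndecomposable_of_uniform (uniform_submodule hu _))
        (hi' ▸ hproper _ hi X hX hS _ hT)
      refine (this (N.submoduleOf (N ⊔ N')) (N'.submoduleOf (N ⊔ N'))).imp ?_ ?_
      · exact fun h x hx => h (show (⟨x, (le_sup_left : N ≤ N ⊔ N') hx⟩ :
          (N ⊔ N' : Submodule Aᵐᵒᵖ X)) ∈ N.submoduleOf (N ⊔ N') from hx)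
      · exact fun h x hx => h (show (⟨x, (le_sup_right : N' ≤ N ⊔ N') hx⟩ :
          (N ⊔ N' : Submodule Aᵐᵒᵖ X)) ∈ N'.submoduleOf (N ⊔ N') from hx)

end Uniserial
-- Dual bases of projective ideals
section DualBasis

variable {B : Type*} [Ring B] (H : TwoSidedIdeal B)

/-- The coordinates come from a section of the canonical free cover. Only finitely many elements are
expanded, so finite generation of `H` is not needed. -/
theorem exists_dualBasis_right [Module.Projective Bᵐᵒᵖ H] {ι : Type*} [Fintype ι] (h : ι → H) :
    ∃ (F : Finset H) (φ : H → H →+ B), (∀ u x b, φ u (MulOpposite.op b • x) = φ u x * b) ∧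
      ∀ i, (h i : B) = ∑ u ∈ F, (u : B) * φ u (h i) := by
  classical
  obtain ⟨s, hs⟩ := Module.projective_def.1 (inferInstance : Module.Projective Bᵐᵒᵖ H)
  refine ⟨Finset.univ.biUnion fun i => (s (h i)).support, fun u =>
    { toFun := fun x => (s x u).unop
      map_zero' := by rw [map_zero]; rfl
      map_add' := fun x y => by rw [map_add]; rfl }, ?_, ?_⟩
  · intro u x b
    change (s (MulOpposite.op b • x) u).unop = _
    rw [map_smul]
    rfl
  · intro i
    conv_lhs => rw [← hs (h i)]
    rw [Finsupp.linearCombination_apply, Finsupp.sum_of_support_subset (s := Finset.univ.biUnion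
      fun i => (s (h i)).support) _ (Finset.subset_biUnion_of_mem
      (fun i => (s (h i)).support) (Finset.mem_univ i)) _ (by simp)]
    change TwoSidedIdeal.subtype H _ = _
    rw [map_sum]
    rfl

theorem exists_dualBasis_left [Module.Projective B H] {ι : Type*} [Fintype ι] (h : ι → H) :
    ∃ (F : Finset H) (φ : H → H →ₗ[B] B), ∀ i, (h i : B) = ∑ u ∈ F, φ u (h i) * (u : B) := by
  classical
  obtain ⟨s, hs⟩ := Module.projective_def.1 (inferInstance : Module.Projective B H)
  refine ⟨Finset.univ.biUnion fun i => (s (h i)).support, fun u => Finsupp.lapply u ∘ₗ s, ?_⟩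
  intro i
  conv_lhs => rw [← hs (h i)]
  rw [Finsupp.linearCombination_apply, Finsupp.sum_of_support_subset (s := Finset.univ.biUnion
    fun i => (s (h i)).support) _ (Finset.subset_biUnion_of_mem
    (fun i => (s (h i)).support) (Finset.mem_univ i)) _ (by simp)]
  change TwoSidedIdeal.subtype H _ = _
  rw [map_sum]
  rfl

end DualBasis

/-! ### Closure properties of projective ideals of `End M` -/

section AuslanderIdeals

variable {A : Type u} [Ring A] {M : Type u} [AddCommGroup M] [Module Aᵐᵒᵖ M]

/-- The working form of `add M = mod A`: the identity of `N` is a finite sum of maps through `M`. In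
particular `M` generates and cogenerates. -/
theorem IsAdditiveGenerator.exists_sum_eq (hM : IsAdditiveGenerator A M) (N : Type u)
    [AddCommGroup N] [Module Aᵐᵒᵖ N] [Module.Finite Aᵐᵒᵖ N] :
    ∃ (k : ℕ) (s : Fin k → N →ₗ[Aᵐᵒᵖ] M) (r : Fin k → M →ₗ[Aᵐᵒᵖ] N),
      ∀ x, ∑ j, r j (s j x) = x := by
  obtain ⟨k, s, r, h⟩ := hM.summand N inferInstance
  refine ⟨k, fun j => LinearMap.proj j ∘ₗ s,
    fun j => r ∘ₗ LinearMap.single Aᵐᵒᵖ (fun _ => M) j, fun x => ?_⟩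
  have := LinearMap.congr_fun h x
  simp only [LinearMap.comp_apply, LinearMap.proj_apply, ← map_sum]
  simp only [LinearMap.single_apply]
  rw [Finset.univ_sum_single]
  exact this

theorem IsAdditiveGenerator.eq_zero_of_forall (hM : IsAdditiveGenerator A M) {N : Type u}
    [AddCommGroup N] [Module Aᵐᵒᵖ N] [Module.Finite Aᵐᵒᵖ N] {x : N}
    (h : ∀ b : N →ₗ[Aᵐᵒᵖ] M, b x = 0) : x = 0 := by
  obtain ⟨k, s, r, hsr⟩ := hM.exists_sum_eq N
  rw [← hsr x]
  simp [h]

theorem IsAdditiveGenerator.mem_of_forall (hM : IsAdditiveGenerator A M) {N : Type u}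
    [AddCommGroup N] [Module Aᵐᵒᵖ N] [Module.Finite Aᵐᵒᵖ N] {P : Submodule Aᵐᵒᵖ N}
    (h : ∀ (a : M →ₗ[Aᵐᵒᵖ] N) m, a m ∈ P) (x : N) : x ∈ P := by
  obtain ⟨k, s, r, hsr⟩ := hM.exists_sum_eq N
  rw [← hsr x]
  exact sum_mem fun j _ => h _ _

/-- `H` contains all endomorphisms with image in `H M`. -/
def RightClosed (H : TwoSidedIdeal (Module.End Aᵐᵒᵖ M)) : Prop :=
  ∀ f : Module.End Aᵐᵒᵖ M, (∀ m, f m ∈ ⨆ h : H, LinearMap.range h.1) → f ∈ H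

/-- `H` contains all endomorphisms that vanish on the common kernel of the elements of `H`. -/
def LeftClosed (H : TwoSidedIdeal (Module.End Aᵐᵒᵖ M)) : Prop :=
  ∀ f : Module.End Aᵐᵒᵖ M, (∀ m, (∀ h ∈ H, h m = 0) → f m = 0) → f ∈ H

/-- The modules `X` such that all maps `M → X → M` belong to the ideal `H`. -/
def IdealClass (H : TwoSidedIdeal (Module.End Aᵐᵒᵖ M)) (X : Type u) [AddCommGroup X]
    [Module Aᵐᵒᵖ X] : Prop :=
  ∀ (a : M →ₗ[Aᵐᵒᵖ] X) (b : X →ₗ[Aᵐᵒᵖ] M), (b ∘ₗ a : Module.End Aᵐᵒᵖ M) ∈ H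

theorem exists_linearMap_range {S X Y Z : Type*} [Ring S] [AddCommGroup X] [Module S X]
    [AddCommGroup Y] [Module S Y] [AddCommGroup Z] [Module S Z] (h : X →ₗ[S] Y) (f : X →ₗ[S] Z)
    (hf : ∀ x, h x = 0 → f x = 0) :
    ∃ g : LinearMap.range h →ₗ[S] Z, ∀ x, g ⟨h x, x, rfl⟩ = f x := by
  refine ⟨(LinearMap.ker h).liftQ f (fun x hx => hf x hx) ∘ₗ h.quotKerEquivRange.symm.toLinearMap,
    fun x => ?_⟩
  have : h.quotKerEquivRange.symm ⟨h x, x, rfl⟩ = (LinearMap.ker h).mkQ x := by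
    rw [LinearEquiv.symm_apply_eq]; rfl
  simp only [LinearMap.comp_apply, LinearEquiv.coe_coe, this]
  exact Submodule.liftQ_apply _ _ _

/-- Choose `h : M ^ t → M` with entries in `H` and image `H M`. Applying a coordinate `φ u` to the
entries gives `θ u : M ^ t → M`. Right linearity turns a relation `h ∘ a = 0` into `θ u ∘ a = 0`;
since `M` generates `ker h`, `θ u` descends to `ψ u : H M → M`. The dual basis identity then reads
`f = ∑ u ∘ ψ u ∘ f`, which lies in `H`. -/
theorem RightClosed.of_projective [IsArtinianRing Aᵐᵒᵖ] (hM : IsAdditiveGenerator A M)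
    (H : TwoSidedIdeal (Module.End Aᵐᵒᵖ M))
    [Module.Projective (Module.End Aᵐᵒᵖ M)ᵐᵒᵖ H] : RightClosed H := by
  classical
  intro f hf
  have := hM.finite
  -- By the ascending chain condition on `M`, finitely many ranges already span `H M`.
  obtain ⟨t, ht⟩ := Finset.exists_sup_ge (fun h : H => LinearMap.range h.1)
  obtain ⟨F, φ, hφ, hF⟩ := exists_dualBasis_right H (fun i : t => i.1)
  let h : (t → M) →ₗ[Aᵐᵒᵖ] M := ∑ i : t, i.1.1 ∘ₗ LinearMap.proj i
  let θ : H → (t → M) →ₗ[Aᵐᵒᵖ] M := fun u => ∑ i : t, φ u i.1 ∘ₗ LinearMap.proj i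
  have hh : ∀ v, h v = ∑ i : t, i.1.1 (v i) := fun v => by simp [h]
  have hθ : ∀ u v, θ u v = ∑ i : t, φ u i.1 (v i) := fun u v => by simp [θ]
  have hker : ∀ u v, h v = 0 → θ u v = 0 := by
    intro u v hv
    refine hM.mem_of_forall (N := LinearMap.ker h) (P := (LinearMap.ker (θ u)).submoduleOf _)
      (fun a m => ?_) ⟨v, hv⟩
    let c : t → Module.End Aᵐᵒᵖ M := fun i =>
      LinearMap.proj i ∘ₗ (LinearMap.ker h).subtype ∘ₗ a
    have hc : ∑ i : t, MulOpposite.op (c i) • i.1 = 0 := by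
      apply Subtype.ext
      change TwoSidedIdeal.subtype H _ = 0
      rw [map_sum]
      ext m
      refine Eq.trans ?_ (a m).2
      rw [hh, LinearMap.sum_apply]
      rfl
    have := congrArg (φ u) hc
    simp only [map_sum, hφ, map_zero] at this
    change θ u (a m) = 0
    rw [hθ]
    refine Eq.trans ?_ (LinearMap.congr_fun this m)
    rw [LinearMap.sum_apply]
    rfl
  choose ψ hψ using fun u => exists_linearMap_range h (θ u) (hker u)
  have hrange : ∀ m, f m ∈ LinearMap.range h := by
    intro m
    refine ((iSup_le ht).trans (Finset.sup_le fun i hi => ?_)) (hf m)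
    rintro _ ⟨x, rfl⟩
    refine ⟨Pi.single ⟨i, hi⟩ x, ?_⟩
    rw [hh, Finset.sum_eq_single ⟨i, hi⟩]
    · simp
    · intro j _ hj; simp [Pi.single_eq_of_ne hj]
    · simp
  have hsum : f = ∑ u ∈ F, (u : Module.End Aᵐᵒᵖ M) * (ψ u ∘ₗ f.codRestrict _ hrange) := by
    ext m
    obtain ⟨v, hv⟩ := hrange m
    have : f.codRestrict _ hrange m = ⟨h v, v, rfl⟩ := Subtype.ext hv.symm
    simp only [LinearMap.sum_apply, Module.End.mul_apply, LinearMap.comp_apply, this, hψ, hθ,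
      map_sum]
    rw [← hv, hh, Finset.sum_comm]
    refine Finset.sum_congr rfl fun i _ => ?_
    conv_lhs => rw [hF i]
    simp
  rw [hsum]
  exact sum_mem fun u _ => H.mul_mem_right _ _ u.2

/-- Dual argument: `h : M → M ^ t` has the common kernel of `H` as its kernel. Left linearity, and
the fact that `M` cogenerates `M ^ t / range h`, force every `θ u` to land in `range h`. Factoring
`f = f' ∘ h` gives `f = ∑ f' ∘ θ u ∘ u`. -/
theorem LeftClosed.of_projective [IsArtinianRing Aᵐᵒᵖ] (hM : IsAdditiveGenerator A M)
    (H : TwoSidedIdeal (Module.End Aᵐᵒᵖ M))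
    [Module.Projective (Module.End Aᵐᵒᵖ M) H] : LeftClosed H := by
  classical
  intro f hf
  have := hM.finite
  obtain ⟨t, ht⟩ := Finset.exists_inf_le (fun h : H => LinearMap.ker h.1)
  obtain ⟨F, φ, hF⟩ := exists_dualBasis_left H (fun i : t => i.1)
  let h : M →ₗ[Aᵐᵒᵖ] (t → M) := LinearMap.pi fun i => i.1.1
  let θ : H → M →ₗ[Aᵐᵒᵖ] (t → M) := fun u => LinearMap.pi fun i => φ u i.1
  have hrange : ∀ u m, θ u m ∈ LinearMap.range h := by
    intro u m
    rw [← Submodule.Quotient.mk_eq_zero]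
    refine hM.eq_zero_of_forall fun b => ?_
    let c : t → Module.End Aᵐᵒᵖ M := fun i =>
      b ∘ₗ (LinearMap.range h).mkQ ∘ₗ LinearMap.single Aᵐᵒᵖ (fun _ => M) i
    have key : ∀ g : t → Module.End Aᵐᵒᵖ M, ∀ m, (∑ i, c i * g i) m =
        b ((LinearMap.range h).mkQ fun i => g i m) := by
      intro g m
      simp only [LinearMap.sum_apply, Module.End.mul_apply, c, LinearMap.comp_apply, ← map_sum]
      simp only [LinearMap.single_apply]
      rw [Finset.univ_sum_single]
    have hc : ∑ i : t, c i • i.1 = 0 := by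
      apply Subtype.ext
      change TwoSidedIdeal.subtype H _ = 0
      rw [map_sum]
      ext m
      refine (key (fun i => i.1.1) m).trans ?_
      have : (LinearMap.range h).mkQ (fun i : t => i.1.1 m) = 0 :=
        (Submodule.Quotient.mk_eq_zero _).2 ⟨m, rfl⟩
      rw [this]; simp
    have := congrArg (φ u) hc
    simp only [map_sum, map_zero, map_smul, smul_eq_mul] at this
    have h2 := LinearMap.congr_fun this m
    rw [key] at h2
    exact h2
  have hk : ∀ m, h m = 0 → f m = 0 := by
    intro m hm
    refine hf m fun g hg => ?_
    refine ht ⟨g, hg⟩ ?_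
    rw [Submodule.mem_finsetInf]
    intro i hi
    exact congrFun hm ⟨i, hi⟩
  obtain ⟨f', hf'⟩ := exists_linearMap_range h f hk
  have hsum : f = ∑ u ∈ F, (f' ∘ₗ (θ u).codRestrict _ (hrange u) : Module.End Aᵐᵒᵖ M) *
      (u : Module.End Aᵐᵒᵖ M) := by
    ext m
    rw [← hf']
    simp only [LinearMap.sum_apply, Module.End.mul_apply, LinearMap.comp_apply, ← map_sum]
    congr 1
    apply Subtype.ext
    rw [AddSubmonoidClass.coe_finsetSum]
    ext i
    have := LinearMap.congr_fun (hF i) m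
    simpa [h, θ] using this
  rw [hsum]
  exact sum_mem fun u _ => H.mul_mem_left _ _ u.2

end AuslanderIdeals
-- Factor rings and their radicals
section QuotIdeal

variable {B : Type*} [Ring B]

theorem mem_map_of_surjective {C : Type*} [Ring C] {φ : B →+* C} (hφ : Function.Surjective φ)
    (H : TwoSidedIdeal B) {z : C} : z ∈ H.map φ ↔ ∃ h ∈ H, φ h = z := by
  constructor
  · intro hz
    let K : TwoSidedIdeal C := TwoSidedIdeal.mk' {z | ∃ h ∈ H, φ h = z} ⟨0, H.zero_mem, map_zero φ⟩
      (by rintro _ _ ⟨x, hx, rfl⟩ ⟨y, hy, rfl⟩; exact ⟨x + y, H.add_mem hx hy, map_add φ x y⟩)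
      (by rintro _ ⟨x, hx, rfl⟩; exact ⟨-x, H.neg_mem hx, map_neg φ x⟩)
      (by
        rintro c _ ⟨y, hy, rfl⟩
        obtain ⟨x, rfl⟩ := hφ c
        exact ⟨x * y, H.mul_mem_left _ _ hy, map_mul φ x y⟩)
      (by
        rintro _ c ⟨y, hy, rfl⟩
        obtain ⟨x, rfl⟩ := hφ c
        exact ⟨y * x, H.mul_mem_right _ _ hy, map_mul φ y x⟩)
    have hK : ∀ c, c ∈ K ↔ ∃ h ∈ H, φ h = c := fun c => TwoSidedIdeal.mem_mk' ..
    refine (hK z).1 ((TwoSidedIdeal.span_le (I := K)).2 ?_ hz)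
    rintro _ ⟨h, hh, rfl⟩
    exact (hK _).2 ⟨h, hh, rfl⟩
  · rintro ⟨h, hh, rfl⟩
    exact TwoSidedIdeal.subset_span ⟨h, hh, rfl⟩

theorem mem_quotIdeal {H H' : TwoSidedIdeal B} {z : B ⧸ H'.asIdeal} :
    z ∈ quotIdeal H H' ↔ ∃ h ∈ H, Ideal.Quotient.mk H'.asIdeal h = z :=
  mem_map_of_surjective Ideal.Quotient.mk_surjective H

theorem KillsRadical.mul_mul_mem {H H' : TwoSidedIdeal B} (h : KillsRadical (quotIdeal H H'))
    {x j y : B} (hx : x ∈ H) (hj : j ∈ Ring.jacobson B) (hy : y ∈ H) : x * j * y ∈ H' := by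
  have := h _ (mem_quotIdeal.2 ⟨x, hx, rfl⟩) (Ideal.Quotient.mk H'.asIdeal j)
    (Ring.le_comap_jacobson (Ideal.Quotient.mk H'.asIdeal) hj) _ (mem_quotIdeal.2 ⟨y, hy, rfl⟩)
  rw [← map_mul, ← map_mul, Ideal.Quotient.eq_zero_iff_mem] at this
  exact this

theorem mem_jacobson_of_isUnit {x : B} (h : ∀ y, IsUnit (1 - y * x)) : x ∈ Ring.jacobson B := by
  rw [← Ideal.jacobson_bot, Ideal.mem_jacobson_iff]
  intro y
  obtain ⟨z, hz⟩ := (h (-y)).exists_left_inv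
  refine ⟨z, ?_⟩
  rw [Ideal.mem_bot, ← hz]
  noncomm_ring

theorem exists_mul_one_sub_eq_one_of_mem_jacobson {x : B} (h : x ∈ Ring.jacobson B) (y : B) :
    ∃ z, z * (1 - y * x) = 1 := by
  rw [← Ideal.jacobson_bot, Ideal.mem_jacobson_iff] at h
  obtain ⟨z, hz⟩ := h (-y)
  refine ⟨z, ?_⟩
  rw [Ideal.mem_bot] at hz
  rw [← sub_eq_zero, ← hz]
  noncomm_ring

end QuotIdeal

/-! ### From strongly heredity chains to Nakayama algebras -/

section IdealClass

variable {A : Type u} [Ring A] {M : Type u} [AddCommGroup M] [Module Aᵐᵒᵖ M]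

/-- The hypothesis says that `U` is generated by maps from `M` whose composites back to `M` lie in
`H`. Then each `s j` sends `U` into `H M`, so right closedness puts `s j ∘ a` in `H` for every `a`.
-/
theorem RightClosed.idealClass (hM : IsAdditiveGenerator A M)
    {H : TwoSidedIdeal (Module.End Aᵐᵒᵖ M)} (hH : RightClosed H) {U : Type u} [AddCommGroup U]
    [Module Aᵐᵒᵖ U] [Module.Finite Aᵐᵒᵖ U]
    (h : ∀ N : Submodule Aᵐᵒᵖ U, (∀ a : M →ₗ[Aᵐᵒᵖ] U,
      (∀ b : U →ₗ[Aᵐᵒᵖ] M, (b ∘ₗ a : Module.End Aᵐᵒᵖ M) ∈ H) → ∀ m, a m ∈ N) → N = ⊤) :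
    IdealClass H U := by
  intro a b
  obtain ⟨k, s, r, hsr⟩ := hM.exists_sum_eq U
  have hs : ∀ j u, s j u ∈ ⨆ h : H, LinearMap.range h.1 := by
    intro j u
    have := h ((⨆ h : H, LinearMap.range h.1).comap (s j)) (fun g hg m =>
      (le_iSup (fun h : H => LinearMap.range h.1) ⟨_, hg (s j)⟩) ⟨m, rfl⟩)
    have hu : u ∈ (⨆ h : H, LinearMap.range h.1).comap (s j) := this ▸ trivial
    exact hu
  have : (b ∘ₗ a : Module.End Aᵐᵒᵖ M) =
      ∑ j, (b ∘ₗ r j : Module.End Aᵐᵒᵖ M) * (s j ∘ₗ a : Module.End Aᵐᵒᵖ M) := by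
    ext m
    conv_lhs => rw [LinearMap.comp_apply, ← hsr (a m)]
    simp
  rw [this]
  exact sum_mem fun j _ => H.mul_mem_left _ _ (hH _ fun m => hs j _)

/-- Dually, `U` is cogenerated by maps to `M` that compose into `H`, so each `r j` vanishes on the
common kernel of `H`. -/
theorem LeftClosed.idealClass (hM : IsAdditiveGenerator A M)
    {H : TwoSidedIdeal (Module.End Aᵐᵒᵖ M)} (hH : LeftClosed H) {U : Type u} [AddCommGroup U]
    [Module Aᵐᵒᵖ U] [Module.Finite Aᵐᵒᵖ U]
    (h : ∀ x : U, (∀ b : U →ₗ[Aᵐᵒᵖ] M,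
      (∀ a : M →ₗ[Aᵐᵒᵖ] U, (b ∘ₗ a : Module.End Aᵐᵒᵖ M) ∈ H) → b x = 0) → x = 0) :
    IdealClass H U := by
  intro a b
  obtain ⟨k, s, r, hsr⟩ := hM.exists_sum_eq U
  have : (b ∘ₗ a : Module.End Aᵐᵒᵖ M) =
      ∑ j, (b ∘ₗ r j : Module.End Aᵐᵒᵖ M) * (s j ∘ₗ a : Module.End Aᵐᵒᵖ M) := by
    ext m
    conv_lhs => rw [LinearMap.comp_apply, ← hsr (a m)]
    simp
  rw [this]
  refine sum_mem fun j _ => H.mul_mem_right _ _ (hH _ fun m hm => ?_)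
  have : r j m = 0 := h _ fun b' hb' => hm _ (hb' (r j))
  simp [this]

/-- Expanding the identities of `X` and `Y` through `M` writes the composite as a sum of products `x
* j * y` with `x, y ∈ H` and `j` in the radical of `End M`. This replaces cosemisimplicity for
chains of ideals. -/
theorem IdealClass.comp_mem_of_radical (hM : IsAdditiveGenerator A M)
    {H H' : TwoSidedIdeal (Module.End Aᵐᵒᵖ M)} (hk : KillsRadical (quotIdeal H H'))
    {X Y : Type u} [AddCommGroup X] [Module Aᵐᵒᵖ X] [Module.Finite Aᵐᵒᵖ X] [AddCommGroup Y]
    [Module Aᵐᵒᵖ Y] [Module.Finite Aᵐᵒᵖ Y] (hX : IdealClass H X) (hY : IdealClass H Y)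
    (f : X →ₗ[Aᵐᵒᵖ] Y) (hf : ∀ g : Y →ₗ[Aᵐᵒᵖ] X, IsUnit (1 - g ∘ₗ f : Module.End Aᵐᵒᵖ X))
    (a : M →ₗ[Aᵐᵒᵖ] X) (b : Y →ₗ[Aᵐᵒᵖ] M) : (b ∘ₗ f ∘ₗ a : Module.End Aᵐᵒᵖ M) ∈ H' := by
  obtain ⟨k, s, r, hsr⟩ := hM.exists_sum_eq X
  obtain ⟨k', s', r', hsr'⟩ := hM.exists_sum_eq Y
  have : (b ∘ₗ f ∘ₗ a : Module.End Aᵐᵒᵖ M) = ∑ i, ∑ j, (b ∘ₗ r' i : Module.End Aᵐᵒᵖ M) *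
      (s' i ∘ₗ f ∘ₗ r j : Module.End Aᵐᵒᵖ M) * (s j ∘ₗ a : Module.End Aᵐᵒᵖ M) := by
    ext m
    conv_lhs => rw [LinearMap.comp_apply, ← hsr' ((f ∘ₗ a) m), LinearMap.comp_apply, ← hsr (a m)]
    simp
  rw [this]
  refine sum_mem fun i _ => sum_mem fun j _ => hk.mul_mul_mem (hY _ _) ?_ (hX _ _)
  refine mem_jacobson_of_isUnit fun y => ?_
  exact isUnit_one_sub_comp_comm (y ∘ₗ s' i ∘ₗ f) (r j) (hf (r j ∘ₗ y ∘ₗ s' i))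

end IdealClass

theorem isNakayama_of_isStronglyQuasiHereditary {A : Type u} [Ring A] [IsArtinianRing Aᵐᵒᵖ]
    {M : Type u} [AddCommGroup M] [Module Aᵐᵒᵖ M] (hM : IsAdditiveGenerator A M)
    (h : IsStronglyQuasiHereditary (AuslanderAlgebra A M)) : IsNakayama A := by
  obtain ⟨n, H, -, hr, hl⟩ := h
  have hR : ∀ i ≤ n, RightClosed (H i) := by
    intro i hi
    -- Projectivity is given for `i < n`; at `i = n` the ideal is zero and closedness is immediate.
    rcases hi.lt_or_eq with hi | rfl
    · have := hr.projective i hi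
      exact RightClosed.of_projective hM _
    · rw [hr.last]
      intro f hf
      have : (⨆ h : (⊥ : TwoSidedIdeal (Module.End Aᵐᵒᵖ M)), LinearMap.range h.1) = ⊥ := by
        rw [eq_bot_iff]
        refine iSup_le fun h => ?_
        rw [(TwoSidedIdeal.mem_bot _).1 h.2, LinearMap.range_zero]
      rw [TwoSidedIdeal.mem_bot]
      ext m
      have := this ▸ hf m
      simpa using this
  have hL : ∀ i ≤ n, LeftClosed (H i) := by
    intro i hi
    rcases hi.lt_or_eq with hi | rfl
    · have := hl.projective i hi
      exact LeftClosed.of_projective hM _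
    · rw [hr.last]
      intro f hf
      rw [TwoSidedIdeal.mem_bot]
      ext m
      exact hf m fun h hh => by rw [(TwoSidedIdeal.mem_bot _).1 hh]; rfl
  have hfactor : ∀ i < n, ∀ (X : Type u) [AddCommGroup X] [Module Aᵐᵒᵖ X]
      [Module.Finite Aᵐᵒᵖ X], IsIndecomposable A X → IdealClass (H i) X →
      ∀ U : Submodule Aᵐᵒᵖ X, U ≠ ⊥ → ∀ (a : M →ₗ[Aᵐᵒᵖ] X) (b : X ⧸ U →ₗ[Aᵐᵒᵖ] M),
        (b ∘ₗ U.mkQ ∘ₗ a : Module.End Aᵐᵒᵖ M) ∈ H (i + 1) := by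
    intro i hi X _ _ _ hX hS U hU
    refine IdealClass.comp_mem_of_radical hM (hr.killsRadical i hi) hS ?_ U.mkQ ?_
    · refine (hR i hi.le).idealClass hM fun N hN => ?_
      have : N.comap U.mkQ = ⊤ := eq_top_iff.2 fun x _ => hM.mem_of_forall
        (fun a m => hN (U.mkQ ∘ₗ a) (fun b => hS a (b ∘ₗ U.mkQ)) m) x
      rw [← Submodule.map_comap_eq_of_surjective U.mkQ_surjective N, this, Submodule.map_top,
        Submodule.range_mkQ]
    · intro g
      -- An endomorphism factoring through `X / U` kills `U`, so it is not a unit.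
      refine hX.isUnit_one_sub fun hu => hU ?_
      have hinj : Function.Injective (g ∘ₗ U.mkQ) := ((Module.End.isUnit_iff _).1 hu).1
      rw [eq_bot_iff]
      intro x hx
      refine hinj ?_
      simp [(Submodule.Quotient.mk_eq_zero U).2 hx]
  have hproper : ∀ i < n, ∀ (X : Type u) [AddCommGroup X] [Module Aᵐᵒᵖ X] [Module.Finite Aᵐᵒᵖ X],
      IsIndecomposable A X → IdealClass (H i) X → ∀ U : Submodule Aᵐᵒᵖ X, U ≠ ⊤ →
      ∀ (a : M →ₗ[Aᵐᵒᵖ] U) (b : X →ₗ[Aᵐᵒᵖ] M),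
        (b ∘ₗ U.subtype ∘ₗ a : Module.End Aᵐᵒᵖ M) ∈ H (i + 1) := by
    intro i hi X _ _ _ hX hS U hU
    refine IdealClass.comp_mem_of_radical hM (hr.killsRadical i hi) ?_ hS U.subtype ?_
    · refine (hL i hi.le).idealClass hM fun x hx => ?_
      refine Subtype.ext (hM.eq_zero_of_forall fun b => hx (b ∘ₗ U.subtype) fun a => ?_)
      exact hS (U.subtype ∘ₗ a) b
    · intro g
      refine isUnit_one_sub_comp_comm g U.subtype (hX.isUnit_one_sub fun hu => hU ?_)
      rw [eq_top_iff]
      intro x _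
      obtain ⟨y, rfl⟩ := ((Module.End.isUnit_iff _).1 hu).2 x
      exact (g y).2
  refine isNakayama_of_filtration n (fun i X _ _ => IdealClass (H i) X) ?_ ?_ ?_ ?_ ?_
  · intro X _ _ _ a b
    rw [hr.zero]
    trivial
  · intro X _ _ _ hX
    refine ⟨fun x y => ?_⟩
    rw [← sub_eq_zero]
    refine hM.eq_zero_of_forall fun b => ?_
    refine hM.mem_of_forall (P := LinearMap.ker b) (fun a m => ?_) _
    have := hX a b
    rw [hr.last, TwoSidedIdeal.mem_bot] at this
    exact LinearMap.congr_fun this m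
  · intro i hi X _ _ _ hX hS U V hU hV hUV
    refine (hL (i + 1) hi).idealClass hM fun x hx => ?_
    -- The maps through `X / W` are admissible tests; those for `U` and `V` confine `x` to `U ⊓ V =
    -- ⊥`.
    have key : ∀ W : Submodule Aᵐᵒᵖ X, W ≠ ⊥ → x ∈ W := fun W hW => by
      rw [← Submodule.Quotient.mk_eq_zero]
      exact hM.eq_zero_of_forall fun b => hx (b ∘ₗ W.mkQ) fun a => hfactor i hi X hX hS W hW a b
    have : x ∈ U ⊓ V := ⟨key U hU, key V hV⟩
    rw [hUV] at this
    exact this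
  · intro i hi X _ _ _ hX hS U V hU hV hUV
    refine (hR (i + 1) hi).idealClass hM fun N hN => ?_
    have key : ∀ W : Submodule Aᵐᵒᵖ X, W ≠ ⊤ → W ≤ N := fun W hW x hx =>
      hM.mem_of_forall (P := N.comap W.subtype) (fun a m =>
        hN (W.subtype ∘ₗ a) (fun b => hproper i hi X hX hS W hW a b) m) ⟨x, hx⟩
    exact eq_top_iff.2 (hUV ▸ sup_le (key U hU) (key V hV))
  · intro i hi X _ _ _ hX hS U hU
    refine (hL (i + 1) hi).idealClass hM fun x hx => ?_
    refine Subtype.ext (hM.eq_zero_of_forall fun b => ?_)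
    exact hx (b ∘ₗ U.subtype) fun a => hproper i hi X hX hS U hU a b

/-! ### Idempotence and projectivity from a dual basis -/

section DualBasisCriteria

theorem projective_of_dualBasis {S P : Type*} [Ring S] [AddCommGroup P] [Module S P] {n : ℕ}
    (u : Fin n → P) (φ : Fin n → P →ₗ[S] S) (h : ∀ x, ∑ j, φ j x • u j = x) :
    Module.Projective S P := by
  refine Module.Projective.of_split (LinearMap.pi φ) (Fintype.linearCombination S u) ?_
  ext x
  simpa [Fintype.linearCombination_apply] using h x

variable {B : Type*} [Ring B] {H H' : TwoSidedIdeal B} {n : ℕ} (u : Fin n → H)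
  (φ : Fin n → H →ₗ[Bᵐᵒᵖ] Bᵐᵒᵖ)

theorem coe_sum_smul (h : ∀ x, ∑ j, φ j x • u j = x) (x : H) :
    ∑ j, (u j : B) * (φ j x).unop = x := by
  conv_rhs => rw [← h x]
  change _ = TwoSidedIdeal.subtype H _
  rw [map_sum]
  rfl

theorem isIdempotentIdeal_of_dualBasis (h : ∀ x, ∑ j, φ j x • u j = x)
    (hφ : ∀ j x, (φ j x).unop ∈ H) : IsIdempotentIdeal H := by
  refine le_antisymm Ideal.mul_le_right fun x hx => ?_
  rw [show x = (⟨x, hx⟩ : H) from rfl, ← coe_sum_smul u φ h ⟨x, hx⟩]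
  exact sum_mem fun j _ => Ideal.mul_mem_mul (u j).2 (hφ j _)

theorem IsIdempotentIdeal.quotIdeal (h : IsIdempotentIdeal H) :
    IsIdempotentIdeal (quotIdeal H H') := by
  refine le_antisymm Ideal.mul_le_right fun z hz => ?_
  obtain ⟨x, hx, rfl⟩ := mem_quotIdeal.1 hz
  have hle : H.asIdeal * H.asIdeal ≤ Ideal.comap (Ideal.Quotient.mk H'.asIdeal)
      ((StronglyQH.quotIdeal H H').asIdeal * (StronglyQH.quotIdeal H H').asIdeal) := by
    refine Ideal.mul_le.2 fun a ha b hb => ?_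
    rw [Ideal.mem_comap, map_mul]
    exact Ideal.mul_mem_mul (mem_quotIdeal.2 ⟨a, ha, rfl⟩) (mem_quotIdeal.2 ⟨b, hb, rfl⟩)
  exact hle (h.symm ▸ hx)

/-- Coordinates that preserve `H'` descend to a dual basis of `H / H'`; `key` is the independence of
the chosen lift. -/
theorem projective_quotIdeal_of_dualBasis (h : ∀ x, ∑ j, φ j x • u j = x)
    (hφ : ∀ j (x : H), (x : B) ∈ H' → (φ j x).unop ∈ H') :
    Module.Projective (B ⧸ H'.asIdeal)ᵐᵒᵖ (quotIdeal H H') := by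
  let π := Ideal.Quotient.mk H'.asIdeal
  choose l hl using fun z : quotIdeal H H' => mem_quotIdeal.1 z.2
  let L : quotIdeal H H' → H := fun z => ⟨l z, (hl z).1⟩
  have hL : ∀ z, π (L z : B) = z := fun z => (hl z).2
  have key : ∀ j (x y : H), π (x : B) = π (y : B) → π (φ j x).unop = π (φ j y).unop := by
    intro j x y hxy
    rw [Ideal.Quotient.eq] at hxy ⊢
    have := hφ j (x - y) hxy
    rwa [map_sub] at this
  refine projective_of_dualBasis (n := n)
    (fun j => ⟨π (u j : B), mem_quotIdeal.2 ⟨_, (u j).2, rfl⟩⟩)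
    (fun j =>
      { toFun := fun z => MulOpposite.op (π (φ j (L z)).unop)
        map_add' := fun z w => by
          have := key j (L (z + w)) (L z + L w) (by
            rw [hL]
            exact (congrArg₂ (· + ·) (hL z) (hL w)).symm)
          rw [this, map_add, MulOpposite.unop_add, map_add, MulOpposite.op_add]
        map_smul' := fun c z => by
          obtain ⟨b, hb⟩ := Ideal.Quotient.mk_surjective c.unop
          have := key j (L (c • z)) (MulOpposite.op b • L z) (by
            rw [hL]
            change (z : B ⧸ H'.asIdeal) * c.unop = π ((L z : B) * b)
            rw [map_mul, hL, ← hb])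
          rw [this, map_smul, smul_eq_mul, MulOpposite.unop_mul, map_mul, MulOpposite.op_mul]
          simp only [MulOpposite.unop_op, RingHom.id_apply, smul_eq_mul]
          congr 1
          exact MulOpposite.unop_injective hb }) ?_
  intro z
  apply Subtype.ext
  change TwoSidedIdeal.subtype (quotIdeal H H') _ = _
  rw [map_sum]
  conv_rhs => rw [← hL z, ← coe_sum_smul u φ h (L z), map_sum]
  exact Finset.sum_congr rfl fun j _ => (map_mul π _ _).symm

end DualBasisCriteria

/-! ### Annihilator ideals: Nakayama implies strongly quasi-hereditary -/

section Annihilators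

variable {A : Type u} [Ring A]

/-- The elements annihilated by the two-sided ideal `I`. -/
def annihilatedBy (I : Ideal Aᵐᵒᵖ) [I.IsTwoSided] (X : Type u) [AddCommGroup X] [Module Aᵐᵒᵖ X] :
    Submodule Aᵐᵒᵖ X where
  carrier := {x | ∀ a ∈ I, a • x = 0}
  zero_mem' := fun a _ => smul_zero a
  add_mem' := fun hx hy a ha => by rw [smul_add, hx a ha, hy a ha, add_zero]
  smul_mem' := fun c x hx a ha => by rw [← mul_smul]; exact hx _ (I.mul_mem_right c ha)

variable {M : Type u} [AddCommGroup M] [Module Aᵐᵒᵖ M]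

variable (M) in
/-- The endomorphisms of `M` whose image is annihilated by `I`. -/
def annihilatedIdeal (I : Ideal Aᵐᵒᵖ) : TwoSidedIdeal (Module.End Aᵐᵒᵖ M) :=
  TwoSidedIdeal.mk' {f | ∀ a ∈ I, ∀ x, a • f x = 0}
    (fun a _ _ => smul_zero a)
    (fun hf hg a ha x => by rw [LinearMap.add_apply, smul_add, hf a ha, hg a ha, add_zero])
    (fun hf a ha x => by rw [LinearMap.neg_apply, smul_neg, hf a ha, neg_zero])
    (fun {g f} hf a ha x => by rw [Module.End.mul_apply, ← map_smul, hf a ha, map_zero])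
    (fun {f g} hf a ha x => hf a ha _)

theorem mem_annihilatedIdeal {I : Ideal Aᵐᵒᵖ} {f : Module.End Aᵐᵒᵖ M} :
    f ∈ annihilatedIdeal M I ↔ ∀ a ∈ I, ∀ x, a • f x = 0 :=
  TwoSidedIdeal.mem_mk' ..

/-- The ideal is `Hom(M, N)` with `N` the part of `M` killed by `I`, and `N` is a summand of a power
of `M`. Coordinates are composition with maps out of `N`, so they respect every other annihilator
ideal: `I' = I` yields idempotence, a smaller ideal of the chain yields projectivity of the factor.
-/
theorem exists_dualBasis_annihilatedIdeal_right [IsArtinianRing Aᵐᵒᵖ]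
    (hM : IsAdditiveGenerator A M) (I : Ideal Aᵐᵒᵖ) [I.IsTwoSided] :
    ∃ (n : ℕ) (u : Fin n → annihilatedIdeal M I)
      (φ : Fin n → annihilatedIdeal M I →ₗ[(Module.End Aᵐᵒᵖ M)ᵐᵒᵖ] (Module.End Aᵐᵒᵖ M)ᵐᵒᵖ),
      (∀ x, ∑ j, φ j x • u j = x) ∧ ∀ I' j (x : annihilatedIdeal M I),
        (x : Module.End Aᵐᵒᵖ M) ∈ annihilatedIdeal M I' → (φ j x).unop ∈ annihilatedIdeal M I' := by
  have := hM.finite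
  obtain ⟨n, s, r, hsr⟩ := hM.exists_sum_eq (annihilatedBy I M)
  let c : annihilatedIdeal M I → M →ₗ[Aᵐᵒᵖ] annihilatedBy I M := fun f =>
    f.1.codRestrict (annihilatedBy I M) fun x a ha => mem_annihilatedIdeal.1 f.2 a ha x
  refine ⟨n, fun j => ⟨(annihilatedBy I M).subtype ∘ₗ r j, mem_annihilatedIdeal.2
      fun a ha x => (r j x).2 a ha⟩, fun j =>
    { toFun := fun f => MulOpposite.op (s j ∘ₗ c f)
      map_add' := fun f g => MulOpposite.unop_injective (LinearMap.ext fun x =>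
        (s j).map_add (c f x) (c g x))
      map_smul' := fun b f => rfl }, fun f => ?_, fun I' j f hf => ?_⟩
  · apply Subtype.ext
    change TwoSidedIdeal.subtype _ _ = _
    rw [map_sum]
    ext x
    refine Eq.trans ?_ (congrArg Subtype.val (hsr (c f x)))
    rw [LinearMap.sum_apply, AddSubmonoidClass.coe_finsetSum]
    rfl
  · refine mem_annihilatedIdeal.2 fun a ha x => ?_
    have : a • c f x = 0 := Subtype.ext (mem_annihilatedIdeal.1 hf a ha x)
    change a • s j (c f x) = 0
    rw [← map_smul, this, map_zero]

/-- As a left module the ideal is `Hom(M / I M, M)`, and `M / I M` is a summand of a power of `M`.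
-/
theorem projective_annihilatedIdeal_left [IsArtinianRing Aᵐᵒᵖ]
    (hM : IsAdditiveGenerator A M) (I : Ideal Aᵐᵒᵖ) :
    Module.Projective (Module.End Aᵐᵒᵖ M) (annihilatedIdeal M I) := by
  have := hM.finite
  set N : Submodule Aᵐᵒᵖ M := I • ⊤
  obtain ⟨n, s, r, hsr⟩ := hM.exists_sum_eq (M ⧸ N)
  have hN : ∀ f : annihilatedIdeal M I, N ≤ LinearMap.ker f.1 := fun f =>
    Submodule.smul_le.2 fun a ha x _ => by
      rw [LinearMap.mem_ker, map_smul]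
      exact mem_annihilatedIdeal.1 f.2 a ha x
  refine projective_of_dualBasis (n := n)
    (fun j => ⟨s j ∘ₗ N.mkQ, mem_annihilatedIdeal.2 fun a ha x => ?_⟩)
    (fun j =>
    { toFun := fun f => N.liftQ f.1 (hN f) ∘ₗ r j
      map_add' := fun f g => ?_
      map_smul' := fun b f => ?_ }) fun f => ?_
  · rw [LinearMap.comp_apply, ← map_smul, ← map_smul]
    have : N.mkQ (a • x) = 0 :=
      (Submodule.Quotient.mk_eq_zero _).2 (Submodule.smul_mem_smul ha trivial)
    rw [this, map_zero]
  · ext x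
    obtain ⟨y, hy⟩ := N.mkQ_surjective (r j x)
    simp only [LinearMap.comp_apply, LinearMap.add_apply, ← hy]
    rfl
  · ext x
    obtain ⟨y, hy⟩ := N.mkQ_surjective (r j x)
    simp only [LinearMap.comp_apply, RingHom.id_apply, smul_eq_mul, Module.End.mul_apply, ← hy]
    rfl
  · apply Subtype.ext
    change TwoSidedIdeal.subtype _ _ = _
    rw [map_sum]
    ext x
    refine Eq.trans ?_ (congrArg (N.liftQ f.1 (hN f)) (hsr (N.mkQ x)))
    rw [LinearMap.sum_apply, map_sum]
    rfl

/-- If `x b y` is not in the smaller ideal, `b` induces a map from the part of `M` killed by `J ^ (k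
+ 1)` to `M / J ^ (k + 1) M` whose image `J ^ k` does not kill. The retract lemma gives `β b α = 1`
on some `N` not killed by `J ^ k`. Then `1 - α β b` kills `α`, yet is left invertible modulo the
smaller ideal because `b` is radical there; so `J ^ k` kills `N`, a contradiction. -/
theorem IsNakayama.killsRadical [IsArtinianRing Aᵐᵒᵖ] (hA : IsNakayama A)
    (hM : IsAdditiveGenerator A M) (k : ℕ) :
    KillsRadical (quotIdeal (annihilatedIdeal M (Ring.jacobson Aᵐᵒᵖ ^ (k + 1)))
      (annihilatedIdeal M (Ring.jacobson Aᵐᵒᵖ ^ k))) := by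
  have := hM.finite
  set J := Ring.jacobson Aᵐᵒᵖ
  intro x hx j hj y hy
  obtain ⟨x, hxH, rfl⟩ := mem_quotIdeal.1 hx
  obtain ⟨y, hyH, rfl⟩ := mem_quotIdeal.1 hy
  obtain ⟨b, rfl⟩ := Ideal.Quotient.mk_surjective j
  rw [← map_mul, ← map_mul, Ideal.Quotient.eq_zero_iff_mem]
  change x * b * y ∈ annihilatedIdeal M (J ^ k)
  by_contra hc
  set X := annihilatedBy (J ^ (k + 1)) M
  set P : Submodule Aᵐᵒᵖ M := J ^ (k + 1) • ⊤
  have hP : P ≤ LinearMap.ker x := Submodule.smul_le.2 fun a ha z _ => by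
    rw [LinearMap.mem_ker, map_smul]
    exact mem_annihilatedIdeal.1 hxH a ha z
  obtain ⟨N, p, hp, hN⟩ := hA.exists_retract k (X := X) (Y := M ⧸ P)
    (fun a ha z => Subtype.ext (z.2 a ha))
    (fun a ha z => by
      obtain ⟨z, rfl⟩ := P.mkQ_surjective z
      rw [← map_smul]
      exact (Submodule.Quotient.mk_eq_zero _).2 (Submodule.smul_mem_smul ha trivial))
    (P.mkQ ∘ₗ b ∘ₗ X.subtype) (fun h => hc (mem_annihilatedIdeal.2 fun a ha z => by
      have := congrArg (P.liftQ x hP) (h a ha ⟨y z, fun a ha => mem_annihilatedIdeal.1 hyH a ha z⟩)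
      rw [map_smul, map_zero] at this
      exact this))
  let α : N →ₗ[Aᵐᵒᵖ] M := X.subtype ∘ₗ N.subtype
  let β : M →ₗ[Aᵐᵒᵖ] N := p ∘ₗ P.mkQ
  have hβ : ∀ z : N, β (b (α z)) = z := fun z => hp z
  obtain ⟨z, hz⟩ := exists_mul_one_sub_eq_one_of_mem_jacobson hj
    (Ideal.Quotient.mk _ (α ∘ₗ β : Module.End Aᵐᵒᵖ M))
  obtain ⟨z, rfl⟩ := Ideal.Quotient.mk_surjective z
  rw [← map_mul, ← map_one (Ideal.Quotient.mk _), ← map_sub, ← map_mul, Ideal.Quotient.eq] at hz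
  refine hN fun a ha w => Subtype.ext (Subtype.ext ?_)
  have := mem_annihilatedIdeal.1 hz a ha (α w)
  simp only [LinearMap.sub_apply, Module.End.mul_apply, Module.End.one_apply,
    LinearMap.comp_apply, hβ, sub_self, map_zero, zero_sub, smul_neg, neg_eq_zero] at this
  exact this

/-- Test on the regular module modulo `I`: maps `M → M` through it have image killed by `I`, hence
by `I'`. As `M` generates and cogenerates, `I'` kills the class of `1`. -/
theorem IsAdditiveGenerator.le_of_annihilatedIdeal_le (hM : IsAdditiveGenerator A M)
    {I I' : Ideal Aᵐᵒᵖ} [I.IsTwoSided] [I'.IsTwoSided]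
    (hle : annihilatedIdeal M I ≤ annihilatedIdeal M I') : I' ≤ I := by
  intro a ha
  have h0 : a • Submodule.mkQ I (1 : Aᵐᵒᵖ) = 0 := by
    refine hM.eq_zero_of_forall fun b => ?_
    rw [map_smul]
    refine hM.mem_of_forall (P := (annihilatedBy I' M).comap b) (fun c z => ?_)
      (Submodule.mkQ I (1 : Aᵐᵒᵖ)) a ha
    have : (b ∘ₗ c : Module.End Aᵐᵒᵖ M) ∈ annihilatedIdeal M I := by
      refine mem_annihilatedIdeal.2 fun a ha x => ?_
      obtain ⟨y, hy⟩ := Submodule.mkQ_surjective I (c x)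
      rw [LinearMap.comp_apply, ← hy, ← map_smul, ← map_smul]
      have : Submodule.mkQ I (a • y) = 0 :=
        (Submodule.Quotient.mk_eq_zero _).2 (Ideal.mul_mem_right _ _ ha)
      rw [this, map_zero]
    exact fun a ha => mem_annihilatedIdeal.1 (hle this) a ha z
  rw [← map_smul, smul_eq_mul, mul_one] at h0
  exact (Submodule.Quotient.mk_eq_zero _).1 h0

theorem annihilatedIdeal_pow_lt [IsArtinianRing Aᵐᵒᵖ] (hM : IsAdditiveGenerator A M) (k : ℕ)
    (hk : Ring.jacobson Aᵐᵒᵖ ^ k ≠ ⊥) : annihilatedIdeal M (Ring.jacobson Aᵐᵒᵖ ^ k) <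
      annihilatedIdeal M (Ring.jacobson Aᵐᵒᵖ ^ (k + 1)) := by
  have hle : Ring.jacobson Aᵐᵒᵖ ^ (k + 1) ≤ Ring.jacobson Aᵐᵒᵖ ^ k :=
    Ideal.pow_le_pow_right k.le_succ
  refine lt_of_le_not_ge (fun f hf => mem_annihilatedIdeal.2 fun a ha x =>
    mem_annihilatedIdeal.1 hf a (hle ha) x) fun hle => hk ?_
  have hJk := hM.le_of_annihilatedIdeal_le hle
  rw [Ideal.IsTwoSided.pow_succ] at hJk
  -- Nakayama's lemma applied to `J ^ k ≤ J * J ^ k`.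
  exact Submodule.FG.eq_bot_of_le_jacobson_smul (IsNoetherian.noetherian _) hJk

theorem IsNakayama.isStronglyQuasiHereditary [IsArtinianRing Aᵐᵒᵖ] (hA : IsNakayama A)
    (hM : IsAdditiveGenerator A M) : IsStronglyQuasiHereditary (AuslanderAlgebra A M) := by
  classical
  have := hM.finite
  set J := Ring.jacobson Aᵐᵒᵖ with hJdef
  have hJ : ∃ m, J ^ m = ⊥ := IsSemiprimaryRing.isNilpotent
  -- The least exponent is needed: a chain of ideals must be strict.
  set m := Nat.find hJ
  have hm : J ^ m = ⊥ := Nat.find_spec hJ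
  let H : ℕ → TwoSidedIdeal (Module.End Aᵐᵒᵖ M) := fun i => annihilatedIdeal M (J ^ (m - i))
  have hidem : ∀ i, IsIdempotentIdeal (H i) := fun i => by
    obtain ⟨n, u, φ, h, hφ⟩ := exists_dualBasis_annihilatedIdeal_right hM (J ^ (m - i))
    exact isIdempotentIdeal_of_dualBasis u φ h fun j x => hφ _ j x x.2
  have hkill : ∀ i < m, KillsRadical (quotIdeal (H i) (H (i + 1))) := fun i hi => by
    obtain ⟨k, hk⟩ : ∃ k, m - i = k + 1 := ⟨m - i - 1, by omega⟩
    have hk' : m - (i + 1) = k := by omega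
    have e : H i = annihilatedIdeal M (J ^ (k + 1)) := by simp only [H, hk]
    have e' : H (i + 1) = annihilatedIdeal M (J ^ k) := by simp only [H, hk']
    rw [e, e']
    exact hA.killsRadical hM k
  have hchain : IsIdempotentIdealChain m H := by
    refine ⟨?_, ?_, ?_, fun i _ => hidem i⟩
    · rw [eq_top_iff]
      intro f _
      refine mem_annihilatedIdeal.2 fun a ha x => ?_
      rw [Nat.sub_zero, hm, Ideal.mem_bot] at ha
      rw [ha, zero_smul]
    · rw [eq_bot_iff]
      intro f hf
      rw [TwoSidedIdeal.mem_bot]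
      ext x
      simpa using mem_annihilatedIdeal.1 hf 1 (by simp [Submodule.pow_zero]) x
    · intro i hi
      obtain ⟨k, hk⟩ : ∃ k, m - i = k + 1 := ⟨m - i - 1, by omega⟩
      have hk' : m - (i + 1) = k := by omega
      simp only [H, hk, hk']
      exact annihilatedIdeal_pow_lt hM k fun hbot => by
        have := Nat.find_min' hJ hbot
        omega
  refine ⟨m, H, ⟨hchain, fun i hi => ⟨(hidem i).quotIdeal, ?_, hkill i hi⟩⟩,
    ⟨hchain, fun i _ => ?_, hkill⟩,
    ⟨hchain, fun i _ => projective_annihilatedIdeal_left hM _, hkill⟩⟩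
  · obtain ⟨n, u, φ, h, hφ⟩ := exists_dualBasis_annihilatedIdeal_right hM (J ^ (m - i))
    exact projective_quotIdeal_of_dualBasis u φ h (hφ _)
  · obtain ⟨n, u, φ, h, hφ⟩ := exists_dualBasis_annihilatedIdeal_right hM (J ^ (m - i))
    exact projective_of_dualBasis u φ h

end Annihilators
-- Rejective chains through approximations, and transport along equivalences
section Elementary

universe v' u'

variable {C : Type u} [Category.{v} C]

/-- A monic counit makes factorizations through it unique, so objectwise approximations already
assemble into an adjoint. -/
theorem isRightRejective_iff (P : ObjectProperty C) :
    IsRightRejective P ↔ ∀ X : C, ∃ (Y : C) (_ : P Y) (ε : Y ⟶ X), Mono ε ∧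
      ∀ Z, P Z → ∀ f : Z ⟶ X, ∃ g : Z ⟶ Y, g ≫ ε = f := by
  constructor
  · rintro ⟨G, adj, h⟩ X
    refine ⟨(G.obj X).obj, (G.obj X).property, adj.counit.app X, h X, fun Z hZ f => ?_⟩
    let Z' : P.FullSubcategory := ⟨Z, hZ⟩
    refine ⟨(adj.homEquiv Z' X f).hom, ?_⟩
    have := (adj.homEquiv Z' X).symm_apply_apply f
    rw [Adjunction.homEquiv_counit] at this
    exact this
  · intro h
    choose Y hY ε hε g hg using h
    let e : ∀ (Z : P.FullSubcategory) (X : C),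
        (P.ι.obj Z ⟶ X) ≃ (Z ⟶ (⟨Y X, hY X⟩ : P.FullSubcategory)) := fun Z X =>
      { toFun := fun f => ObjectProperty.homMk (g X Z.obj Z.property f)
        invFun := fun k => k.hom ≫ ε X
        left_inv := fun f => hg X Z.obj Z.property f
        right_inv := fun k => by
          ext
          have := hε X
          rw [← cancel_mono (ε X)]
          exact hg X Z.obj Z.property _ }
    have he : ∀ X' X Y' f k, e X' Y' (P.ι.map f ≫ k) = f ≫ e X Y' k := by
      intro X' X Y' f k
      apply (e X' Y').symm.injective
      rw [Equiv.symm_apply_apply]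
      change f.hom ≫ k = (f ≫ e X Y' k).hom ≫ ε Y'
      rw [ObjectProperty.FullSubcategory.comp_hom, Category.assoc]
      congr 1
      exact (hg Y' X.obj X.property k).symm
    refine ⟨_, Adjunction.adjunctionOfEquivRight e he, fun X => ?_⟩
    have : (Adjunction.adjunctionOfEquivRight e he).counit.app X = ε X := by
      rw [Adjunction.adjunctionOfEquivRight_counit_app]
      exact Category.id_comp (ε X)
    rw [this]
    exact hε X

theorem isLeftRejective_iff (P : ObjectProperty C) :
    IsLeftRejective P ↔ ∀ X : C, ∃ (Y : C) (_ : P Y) (η : X ⟶ Y), Epi η ∧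
      ∀ Z, P Z → ∀ f : X ⟶ Z, ∃ g : Y ⟶ Z, η ≫ g = f := by
  constructor
  · rintro ⟨G, adj, h⟩ X
    refine ⟨(G.obj X).obj, (G.obj X).property, adj.unit.app X, h X, fun Z hZ f => ?_⟩
    let Z' : P.FullSubcategory := ⟨Z, hZ⟩
    refine ⟨((adj.homEquiv X Z').symm f).hom, ?_⟩
    have := (adj.homEquiv X Z').apply_symm_apply f
    rw [Adjunction.homEquiv_unit] at this
    exact this
  · intro h
    choose Y hY η hη g hg using h
    let e : ∀ (X : C) (Z : P.FullSubcategory),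
        ((⟨Y X, hY X⟩ : P.FullSubcategory) ⟶ Z) ≃ (X ⟶ P.ι.obj Z) := fun X Z =>
      { toFun := fun k => η X ≫ k.hom
        invFun := fun f => ObjectProperty.homMk (g X Z.obj Z.property f)
        left_inv := fun k => by
          ext
          have := hη X
          rw [← cancel_epi (η X)]
          exact hg X Z.obj Z.property _
        right_inv := fun f => hg X Z.obj Z.property f }
    have he : ∀ X Z Z' k f, e X Z' (f ≫ k) = e X Z f ≫ P.ι.map k :=
      fun X Z Z' k f => (Category.assoc _ _ _).symm
    refine ⟨_, Adjunction.adjunctionOfEquivLeft e he, fun X => ?_⟩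
    have : (Adjunction.adjunctionOfEquivLeft e he).unit.app X = η X := by
      rw [Adjunction.adjunctionOfEquivLeft_unit_app]
      exact Category.comp_id (η X)
    rw [this]
    exact hη X

theorem factorsThrough_inverseImage_iff {P Q : ObjectProperty C} (h : Q ≤ P)
    {X Y : P.FullSubcategory} (f : X ⟶ Y) :
    FactorsThrough (Q.inverseImage P.ι) f ↔ FactorsThrough Q f.hom := by
  constructor
  · rintro ⟨Z, hZ, a, b, rfl⟩
    exact ⟨Z.obj, hZ, a.hom, b.hom, rfl⟩
  · rintro ⟨Z, hZ, a, b, hab⟩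
    exact ⟨⟨Z, h _ hZ⟩, hZ, ObjectProperty.homMk a, ObjectProperty.homMk b,
      ObjectProperty.hom_ext _ hab⟩

variable [Preadditive C]

/-- A rejective chain, expressed in terms of approximations in the ambient category. -/
structure IsApproximationChain (n : ℕ) (S : ℕ → ObjectProperty C) : Prop where
  zero : S 0 = ⊤
  last : ∀ X : C, S n X ↔ Limits.IsZero X
  le : ∀ i < n, S (i + 1) ≤ S i
  additive : ∀ i ≤ n, IsAdditiveSubcategory (S i)
  right : ∀ i < n, ∀ X, S i X → ∃ (Y : C) (_ : S (i + 1) Y) (ε : Y ⟶ X),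
    (∀ Z, S i Z → ∀ f g : Z ⟶ Y, f ≫ ε = g ≫ ε → f = g) ∧
      ∀ Z, S (i + 1) Z → ∀ f : Z ⟶ X, ∃ g : Z ⟶ Y, g ≫ ε = f
  left : ∀ i < n, ∀ X, S i X → ∃ (Y : C) (_ : S (i + 1) Y) (η : X ⟶ Y),
    (∀ Z, S i Z → ∀ f g : Y ⟶ Z, η ≫ f = η ≫ g → f = g) ∧
      ∀ Z, S (i + 1) Z → ∀ f : X ⟶ Z, ∃ g : Y ⟶ Z, η ≫ g = f
  cosemisimple : ∀ i < n, ∀ X Y, S i X → S i Y → ∀ f : X ⟶ Y, InRadicalMod (S (i + 1)) f →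
    FactorsThrough (S (i + 1)) f

theorem inRadicalMod_inverseImage_iff {P Q : ObjectProperty C} (h : Q ≤ P)
    {X Y : P.FullSubcategory} (f : X ⟶ Y) :
    InRadicalMod (Q.inverseImage P.ι) f ↔ InRadicalMod Q f.hom := by
  constructor
  · intro hf g
    obtain ⟨s, h1, h2⟩ := hf (ObjectProperty.homMk g)
    exact ⟨s.hom, (factorsThrough_inverseImage_iff h _).1 h1,
      (factorsThrough_inverseImage_iff h _).1 h2⟩
  · intro hf g
    obtain ⟨s, h1, h2⟩ := hf g.hom
    exact ⟨ObjectProperty.homMk s, (factorsThrough_inverseImage_iff h _).2 h1,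
      (factorsThrough_inverseImage_iff h _).2 h2⟩

theorem isRejectiveChain_iff (n : ℕ) (S : ℕ → ObjectProperty C) :
    IsRejectiveChain n S ↔ IsApproximationChain n S := by
  constructor
  · intro h
    refine ⟨h.zero, h.last, h.le, h.additive, fun i hi X hX => ?_, fun i hi X hX => ?_,
      fun i hi X Y hX hY f hf => ?_⟩
    · obtain ⟨Y, hY, ε, hε, hu⟩ := (isRightRejective_iff _).1 (h.rejective i hi).1 ⟨X, hX⟩
      refine ⟨Y.obj, hY, ε.hom, fun Z hZ f g hfg => ?_, fun Z hZ f => ?_⟩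
      · have := (cancel_mono ε).1 (show (ObjectProperty.homMk f : (⟨Z, hZ⟩ :
          (S i).FullSubcategory) ⟶ Y) ≫ ε = ObjectProperty.homMk g ≫ ε from
          ObjectProperty.hom_ext _ hfg)
        exact congrArg InducedCategory.Hom.hom this
      · obtain ⟨g, hg⟩ := hu ⟨Z, h.le i hi _ hZ⟩ hZ (ObjectProperty.homMk f)
        exact ⟨g.hom, congrArg InducedCategory.Hom.hom hg⟩
    · obtain ⟨Y, hY, ε, hε, hu⟩ := (isLeftRejective_iff _).1 (h.rejective i hi).2 ⟨X, hX⟩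
      refine ⟨Y.obj, hY, ε.hom, fun Z hZ f g hfg => ?_, fun Z hZ f => ?_⟩
      · have := (cancel_epi ε).1 (show ε ≫ (ObjectProperty.homMk f : Y ⟶ (⟨Z, hZ⟩ :
          (S i).FullSubcategory)) = ε ≫ ObjectProperty.homMk g from
          ObjectProperty.hom_ext _ hfg)
        exact congrArg InducedCategory.Hom.hom this
      · obtain ⟨g, hg⟩ := hu ⟨Z, h.le i hi _ hZ⟩ hZ (ObjectProperty.homMk f)
        exact ⟨g.hom, congrArg InducedCategory.Hom.hom hg⟩
    · have := h.cosemisimple i hi (X := ⟨X, hX⟩) (Y := ⟨Y, hY⟩) (ObjectProperty.homMk f)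
        ((inRadicalMod_inverseImage_iff (h.le i hi) _).2 hf)
      exact (factorsThrough_inverseImage_iff (h.le i hi) _).1 this
  · intro h
    refine ⟨h.zero, h.last, h.le, h.additive, fun i hi => ⟨?_, ?_⟩, fun i hi X Y f hf => ?_⟩
    · refine (isRightRejective_iff _).2 fun X => ?_
      obtain ⟨Y, hY, ε, hε, hu⟩ := h.right i hi X.obj X.property
      refine ⟨⟨Y, h.le i hi _ hY⟩, hY, ObjectProperty.homMk ε, ⟨fun f g hfg => ?_⟩,
        fun Z hZ f => ?_⟩
      · exact ObjectProperty.hom_ext _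
          (hε _ (ObjectProperty.FullSubcategory.property _) _ _
            (congrArg InducedCategory.Hom.hom hfg))
      · obtain ⟨g, hg⟩ := hu Z.obj hZ f.hom
        exact ⟨ObjectProperty.homMk g, ObjectProperty.hom_ext _ hg⟩
    · refine (isLeftRejective_iff _).2 fun X => ?_
      obtain ⟨Y, hY, ε, hε, hu⟩ := h.left i hi X.obj X.property
      refine ⟨⟨Y, h.le i hi _ hY⟩, hY, ObjectProperty.homMk ε, ⟨fun f g hfg => ?_⟩,
        fun Z hZ f => ?_⟩
      · exact ObjectProperty.hom_ext _
          (hε _ (ObjectProperty.FullSubcategory.property _) _ _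
            (congrArg InducedCategory.Hom.hom hfg))
      · obtain ⟨g, hg⟩ := hu Z.obj hZ f.hom
        exact ⟨ObjectProperty.homMk g, ObjectProperty.hom_ext _ hg⟩
    · exact (factorsThrough_inverseImage_iff (h.le i hi) _).2 (h.cosemisimple i hi _ _
        X.property Y.property _ ((inRadicalMod_inverseImage_iff (h.le i hi) _).1 hf))

theorem IsAdditiveSubcategory.factorsThrough_map {D : Type u'} [Category.{v'} D] {F : D ⥤ C}
    [F.IsEquivalence] {P : ObjectProperty C} (hP : IsAdditiveSubcategory P) {X Y : D} (f : X ⟶ Y) :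
    FactorsThrough P (F.map f) ↔ FactorsThrough (P.inverseImage F) f := by
  constructor
  · rintro ⟨Z, hZ, a, b, hab⟩
    refine ⟨F.objPreimage Z, hP.iso (F.objObjPreimageIso Z).symm hZ,
      F.preimage (a ≫ (F.objObjPreimageIso Z).inv), F.preimage ((F.objObjPreimageIso Z).hom ≫ b),
      F.map_injective ?_⟩
    simp [hab]
  · rintro ⟨Z, hZ, a, b, rfl⟩
    exact ⟨F.obj Z, hZ, F.map a, F.map b, (F.map_comp a b).symm⟩

theorem HasRejectiveChain.of_isEquivalence {D : Type u'} [Category.{v'} D] [Preadditive D]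
    (F : D ⥤ C) [F.IsEquivalence] [F.Additive] (h : HasRejectiveChain C) :
    HasRejectiveChain D := by
  obtain ⟨n, S, h⟩ := h
  rw [isRejectiveChain_iff] at h
  refine ⟨n, fun i => (S i).inverseImage F, (isRejectiveChain_iff _ _).2 ?_⟩
  refine ⟨?_, fun X => ?_, fun i hi X hX => h.le i hi _ hX, fun i hi => ⟨?_, ?_, ?_⟩,
    fun i hi X hX => ?_, fun i hi X hX => ?_, fun i hi X Y hX hY f hf => ?_⟩
  · rw [h.zero]; rfl
  · refine (h.last _).trans ⟨fun hX => ?_, fun hX => F.map_isZero hX⟩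
    rw [Limits.IsZero.iff_id_eq_zero] at hX ⊢
    exact F.map_injective (by simpa using hX)
  · exact fun e hX => (h.additive i hi).iso (F.mapIso e) hX
  · exact fun Z hZ => (h.additive i hi).zero _ (F.map_isZero hZ)
  · rintro X Y b ⟨hb⟩
    exact (h.additive i hi).sum_iff (F.mapBinaryBicone b)
      -- An additive functor preserves the identity `fst ≫ inl + snd ≫ inr = 𝟙`, which characterizes
      -- biproducts.
      ⟨Limits.isBinaryBilimitOfTotal _ (by
        have := congrArg F.map (Limits.IsBilimit.binary_total hb)
        simp only [Functor.map_add, Functor.map_comp] at this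
        exact this.trans (F.map_id _))⟩
  · obtain ⟨Y, hY, ε, hε, hu⟩ := h.right i hi _ hX
    let θ := F.objObjPreimageIso Y
    refine ⟨F.objPreimage Y, (h.additive (i + 1) hi).iso θ.symm hY, F.preimage (θ.hom ≫ ε),
      fun Z hZ f g hfg => ?_, fun Z hZ f => ?_⟩
    · have := congrArg F.map hfg
      simp only [Functor.map_comp, Functor.map_preimage, ← Category.assoc] at this
      have := hε _ hZ _ _ this
      rw [cancel_mono] at this
      exact F.map_injective this
    · obtain ⟨g, hg⟩ := hu _ hZ (F.map f)
      exact ⟨F.preimage (g ≫ θ.inv), F.map_injective (by simp [hg])⟩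
  · obtain ⟨Y, hY, ε, hε, hu⟩ := h.left i hi _ hX
    let θ := F.objObjPreimageIso Y
    refine ⟨F.objPreimage Y, (h.additive (i + 1) hi).iso θ.symm hY, F.preimage (ε ≫ θ.inv),
      fun Z hZ f g hfg => ?_, fun Z hZ f => ?_⟩
    · have := congrArg F.map hfg
      simp only [Functor.map_comp, Functor.map_preimage, Category.assoc] at this
      have := hε _ hZ _ _ this
      rw [cancel_epi] at this
      exact F.map_injective this
    · obtain ⟨g, hg⟩ := hu _ hZ (F.map f)
      exact ⟨F.preimage (θ.hom ≫ g), F.map_injective (by simp [hg])⟩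
  · rw [← (h.additive (i + 1) hi).factorsThrough_map]
    refine h.cosemisimple i hi _ _ hX hY _ fun g => ?_
    obtain ⟨s, h1, h2⟩ := hf (F.preimage g)
    rw [← (h.additive (i + 1) hi).factorsThrough_map] at h1 h2
    refine ⟨F.map s, ?_, ?_⟩
    · simpa using h1
    · simpa using h2

end Elementary
-- Rejective chains of `mod A`
section ModCatChains

variable {A : Type u} [Ring A]

/-- The linear map underlying a morphism of `mod A`. -/
abbrev ModCat.toLin {X Y : ModCat A} (f : X ⟶ Y) : X →ₗ[Aᵐᵒᵖ] Y := f.hom.hom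

/-- The morphism of `mod A` given by a linear map. -/
abbrev ModCat.ofLin {X Y : ModCat A} (f : X →ₗ[Aᵐᵒᵖ] Y) : X ⟶ Y :=
  ObjectProperty.homMk (ModuleCat.ofHom f)

theorem ModCat.ext_lin {X Y : ModCat A} {f g : X ⟶ Y}
    (h : ∀ x : X, ModCat.toLin f x = ModCat.toLin g x) : f = g :=
  FGModuleCat.hom_ext (LinearMap.ext h)

theorem ModCat.isZero_iff (X : ModCat A) : Limits.IsZero X ↔ Subsingleton X := by
  rw [Limits.IsZero.iff_id_eq_zero]
  constructor
  · intro h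
    refine ⟨fun x y => ?_⟩
    have : ∀ x : X, x = 0 := fun x => congrArg (fun f => ModCat.toLin f x) h
    rw [this x, this y]
  · intro h
    exact ModCat.ext_lin fun x => Subsingleton.elim _ _

/-- The modules annihilated by `I`, as a class of objects of `mod A`. -/
def annihilatedClass (I : Ideal Aᵐᵒᵖ) : ObjectProperty (ModCat A) :=
  fun X => ∀ a ∈ I, ∀ x : X, a • x = 0

theorem annihilatedClass_of_injective {I : Ideal Aᵐᵒᵖ} {X Y : ModCat A} (f : X ⟶ Y)
    (hf : ∀ x : X, ModCat.toLin f x = 0 → x = 0) (hY : annihilatedClass I Y) :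
    annihilatedClass I X := fun a ha x => hf _ (by rw [map_smul]; exact hY a ha _)

theorem annihilatedClass_isAdditive (I : Ideal Aᵐᵒᵖ) :
    IsAdditiveSubcategory (annihilatedClass I) where
  iso {X Y} e hX := annihilatedClass_of_injective e.inv (fun x hx => by
    have := congrArg (fun f => ModCat.toLin f x) e.inv_hom_id
    change ModCat.toLin e.hom (ModCat.toLin e.inv x) = x at this
    rw [← this, hx, map_zero]) hX
  zero Z hZ a _ x := by
    have := (ModCat.isZero_iff Z).1 hZ
    exact Subsingleton.elim _ _
  sum_iff {X Y} b hb := by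
    obtain ⟨hb⟩ := hb
    constructor
    · intro h
      refine ⟨annihilatedClass_of_injective b.inl (fun x hx => ?_) h,
        annihilatedClass_of_injective b.inr (fun x hx => ?_) h⟩
      · have := congrArg (fun f => ModCat.toLin f x) b.inl_fst
        change ModCat.toLin b.fst (ModCat.toLin b.inl x) = x at this
        rw [← this, hx, map_zero]
      · have := congrArg (fun f => ModCat.toLin f x) b.inr_snd
        change ModCat.toLin b.snd (ModCat.toLin b.inr x) = x at this
        rw [← this, hx, map_zero]
    · rintro ⟨hX, hY⟩ a ha x
      have := congrArg (fun f => ModCat.toLin f x) (Limits.IsBilimit.binary_total hb)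
      change ModCat.toLin b.inl (ModCat.toLin b.fst x) +
        ModCat.toLin b.inr (ModCat.toLin b.snd x) = x at this
      have h1 : a • ModCat.toLin b.inl (ModCat.toLin b.fst x) = 0 := by
        rw [← map_smul, hX a ha, map_zero]
      have h2 : a • ModCat.toLin b.inr (ModCat.toLin b.snd x) = 0 := by
        rw [← map_smul, hY a ha, map_zero]
      rw [← this, smul_add, h1, h2, add_zero]

/-- If `J ^ k` kills the image, `f` factors through it. Otherwise some `g` inverts `f` on a summand
`N` not killed by `J ^ k`. There `𝟙 - f ≫ g` vanishes, so its inverse modulo the class makes the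
inclusion of `N` factor through a module killed by `J ^ k`. -/
theorem IsNakayama.factorsThrough_of_inRadicalMod [IsArtinianRing Aᵐᵒᵖ] (hA : IsNakayama A) (k : ℕ)
    {X Y : ModCat A} (hX : annihilatedClass (Ring.jacobson Aᵐᵒᵖ ^ (k + 1)) X)
    (hY : annihilatedClass (Ring.jacobson Aᵐᵒᵖ ^ (k + 1)) Y) (f : X ⟶ Y)
    (hf : InRadicalMod (annihilatedClass (Ring.jacobson Aᵐᵒᵖ ^ k)) f) :
    FactorsThrough (annihilatedClass (Ring.jacobson Aᵐᵒᵖ ^ k)) f := by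
  by_cases h : ∀ a ∈ Ring.jacobson Aᵐᵒᵖ ^ k, ∀ x : X, a • ModCat.toLin f x = 0
  · refine ⟨FGModuleCat.of Aᵐᵒᵖ (LinearMap.range (ModCat.toLin f)), ?_,
      FGModuleCat.ofHom (ModCat.toLin f).rangeRestrict,
      FGModuleCat.ofHom (LinearMap.range (ModCat.toLin f)).subtype, rfl⟩
    rintro a ha ⟨_, x, rfl⟩
    exact Subtype.ext (h a ha x)
  · obtain ⟨N, p, hp, hN⟩ := hA.exists_retract k hX hY (ModCat.toLin f) h
    obtain ⟨s, ⟨Z, hZ, c, d, hcd⟩, -⟩ := hf (ModCat.ofLin (N.subtype ∘ₗ p))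
    refine absurd (fun a ha x => ?_) hN
    apply Subtype.ext
    have := congrArg (fun g => ModCat.toLin g (x : X)) hcd
    change ModCat.toLin d (ModCat.toLin c (x : X)) =
      ModCat.toLin s ((x : X) - (p (ModCat.toLin f x) : X)) - (x : X) at this
    rw [hp, sub_self, map_zero, zero_sub] at this
    have h2 : a • (x : X) = - ModCat.toLin d (a • ModCat.toLin c (x : X)) := by
      rw [map_smul, this, smul_neg, neg_neg]
    rw [hZ a ha, map_zero, neg_zero] at h2
    exact h2

theorem IsNakayama.hasRejectiveChain [IsArtinianRing Aᵐᵒᵖ] (hA : IsNakayama A) :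
    HasRejectiveChain (ModCat A) := by
  -- Any exponent will do, since a rejective chain may have repetitions.
  obtain ⟨m, hm⟩ : ∃ m, Ring.jacobson Aᵐᵒᵖ ^ m = ⊥ := IsSemiprimaryRing.isNilpotent
  refine ⟨m, fun i => annihilatedClass (Ring.jacobson Aᵐᵒᵖ ^ (m - i)),
    (isRejectiveChain_iff _ _).2 ⟨?_, fun X => ?_, fun i hi X hX a ha x => ?_,
    fun i _ => annihilatedClass_isAdditive _, fun i hi X hX => ?_, fun i hi X hX => ?_,
    fun i hi X Y hX hY f hf => ?_⟩⟩
  · rw [eq_top_iff]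
    intro X _ a ha x
    rw [Nat.sub_zero, hm, Ideal.mem_bot] at ha
    rw [ha, zero_smul]
  · rw [ModCat.isZero_iff]
    constructor
    · intro h
      have : ∀ x : X, x = 0 := fun x => by
        simpa using h 1 (by simp [Submodule.pow_zero]) x
      exact ⟨fun x y => by rw [this x, this y]⟩
    · intro h a _ x
      exact Subsingleton.elim _ _
  · exact hX a (Ideal.pow_le_pow_right (by omega) ha) x
  · set I := Ring.jacobson Aᵐᵒᵖ ^ (m - (i + 1))
    refine ⟨FGModuleCat.of Aᵐᵒᵖ (annihilatedBy I X), fun a ha x => Subtype.ext (x.2 a ha),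
      ModCat.ofLin (annihilatedBy I X).subtype, fun Z _ f g hfg => ?_, fun Z hZ f => ?_⟩
    · exact ModCat.ext_lin fun x => Subtype.ext (congrArg (fun h => ModCat.toLin h x) hfg)
    · refine ⟨ModCat.ofLin ((ModCat.toLin f).codRestrict (annihilatedBy I X) fun x a ha => ?_), rfl⟩
      rw [← map_smul, hZ a ha, map_zero]
  · set I := Ring.jacobson Aᵐᵒᵖ ^ (m - (i + 1))
    let N : Submodule Aᵐᵒᵖ X := I • ⊤
    refine ⟨FGModuleCat.of Aᵐᵒᵖ (X ⧸ N), fun a ha x => ?_,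
      ModCat.ofLin N.mkQ, fun Z _ f g hfg => ?_, fun Z hZ f => ?_⟩
    · obtain ⟨y, rfl⟩ := N.mkQ_surjective x
      rw [← map_smul]
      exact (Submodule.Quotient.mk_eq_zero _).2 (Submodule.smul_mem_smul ha trivial)
    · refine ModCat.ext_lin fun x => ?_
      obtain ⟨y, rfl⟩ := N.mkQ_surjective x
      exact congrArg (fun h => ModCat.toLin h y) hfg
    · refine ⟨ModCat.ofLin (N.liftQ (ModCat.toLin f) (Submodule.smul_le.2 fun a ha x _ => ?_)), ?_⟩
      · rw [LinearMap.mem_ker, map_smul]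
        exact hZ a ha _
      · exact ModCat.ext_lin fun x => rfl
  · obtain ⟨k, hk⟩ : ∃ k, m - i = k + 1 := ⟨m - i - 1, by omega⟩
    have hk' : m - (i + 1) = k := by omega
    simp only [hk, hk'] at hX hY hf ⊢
    exact hA.factorsThrough_of_inRadicalMod k hX hY f hf

theorem inRadicalMod_of_isUnit {P : ObjectProperty (ModCat A)} (hP : IsAdditiveSubcategory P)
    {X Y : ModCat A} (f : X ⟶ Y) (hf : ∀ g : Y →ₗ[Aᵐᵒᵖ] X,
      IsUnit (1 - g ∘ₗ ModCat.toLin f : Module.End Aᵐᵒᵖ X)) : InRadicalMod P f := by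
  intro g
  obtain ⟨⟨t, s, hts, hst⟩, rfl : t = _⟩ := hf (ModCat.toLin g)
  have hz : ∀ {Z W : ModCat A}, FactorsThrough P (0 : Z ⟶ W) := fun {Z W} =>
    ⟨FGModuleCat.of Aᵐᵒᵖ PUnit, hP.zero _ ((ModCat.isZero_iff _).2 inferInstance), 0, 0, by simp⟩
  refine ⟨ModCat.ofLin s, ?_, ?_⟩
  · convert hz (Z := X) (W := X)
    refine ModCat.ext_lin fun x => ?_
    have := LinearMap.congr_fun hst x
    exact sub_eq_zero.2 this
  · convert hz (Z := X) (W := X)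
    refine ModCat.ext_lin fun x => ?_
    have := LinearMap.congr_fun hts x
    exact sub_eq_zero.2 this

/-- The members of an approximation chain are closed under submodules and factor modules. -/
theorem IsApproximationChain.closed {n : ℕ} {S : ℕ → ObjectProperty (ModCat A)}
    [IsArtinianRing Aᵐᵒᵖ] (h : IsApproximationChain n S) (i : ℕ) (hi : i ≤ n) :
    (∀ {X Y : ModCat A} (f : X ⟶ Y), Function.Injective (ModCat.toLin f) → S i Y → S i X) ∧
    (∀ {X Y : ModCat A} (f : X ⟶ Y), Function.Surjective (ModCat.toLin f) → S i X → S i Y) := by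
  induction i with
  | zero => rw [h.zero]; exact ⟨fun _ _ _ => trivial, fun _ _ _ => trivial⟩
  | succ i ih =>
    obtain ⟨hsub, hquot⟩ := ih (by omega)
    have hiso : ∀ {X Y : ModCat A} (f : X ⟶ Y), Function.Bijective (ModCat.toLin f) → IsIso f := by
      intro X Y f hf
      let e := LinearEquiv.ofBijective _ hf
      exact ⟨ModCat.ofLin e.symm.toLinearMap, ModCat.ext_lin fun x => e.symm_apply_apply x,
        ModCat.ext_lin fun x => e.apply_symm_apply x⟩
    constructor
    · intro X Y f hf hY
      -- The injection `f` factors through `η`, so `η` is injective. Its cokernel lies in `S i` by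
      -- the inductive closure under factor modules, so epicity in `S i` makes it surjective. Hence
      -- `X ≅ Z`; factor modules are handled dually, and the two closures need each other in the
      -- induction.
      obtain ⟨Z, hZ, η, hη, hu⟩ := h.left i (by omega) X (hsub f hf (h.le i (by omega) _ hY))
      obtain ⟨g, rfl⟩ := hu Y hY f
      have hinj : Function.Injective (ModCat.toLin η) := fun x y hxy =>
        hf (congrArg (ModCat.toLin g) hxy)
      have hsurj : Function.Surjective (ModCat.toLin η) := by
        let N := LinearMap.range (ModCat.toLin η)
        have hZ' := h.le i (by omega) _ hZ
        have := hη (FGModuleCat.of Aᵐᵒᵖ (Z ⧸ N))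
          (hquot (ModCat.ofLin N.mkQ) N.mkQ_surjective hZ') (ModCat.ofLin N.mkQ) 0
          (ModCat.ext_lin fun x => (Submodule.Quotient.mk_eq_zero _).2 ⟨x, rfl⟩)
        intro z
        exact (Submodule.Quotient.mk_eq_zero N).1 (congrArg (fun k => ModCat.toLin k z) this)
      have := hiso η ⟨hinj, hsurj⟩
      exact (h.additive (i + 1) hi).iso (asIso η).symm hZ
    · intro X Y f hf hX
      obtain ⟨Z, hZ, ε, hε, hu⟩ := h.right i (by omega) Y (hquot f hf (h.le i (by omega) _ hX))
      obtain ⟨g, rfl⟩ := hu X hX f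
      have hsurj : Function.Surjective (ModCat.toLin ε) := fun y => by
        obtain ⟨x, rfl⟩ := hf y
        exact ⟨ModCat.toLin g x, rfl⟩
      have hinj : Function.Injective (ModCat.toLin ε) := by
        rw [← LinearMap.ker_eq_bot, eq_bot_iff]
        let N := LinearMap.ker (ModCat.toLin ε)
        have hZ' := h.le i (by omega) _ hZ
        have := hε (FGModuleCat.of Aᵐᵒᵖ N)
          (hsub (ModCat.ofLin N.subtype) N.injective_subtype hZ') (ModCat.ofLin N.subtype) 0
          (ModCat.ext_lin fun x => (LinearMap.mem_ker.1 x.2).trans (map_zero (ModCat.toLin ε)).symm)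
        intro z hz
        exact congrArg (fun k => ModCat.toLin k (⟨z, hz⟩ : N)) this
      have := hiso ε ⟨hinj, hsurj⟩
      exact (h.additive (i + 1) hi).iso (asIso ε) hZ

theorem isNakayama_of_hasRejectiveChain [IsArtinianRing Aᵐᵒᵖ] (h : HasRejectiveChain (ModCat A)) :
    IsNakayama A := by
  obtain ⟨n, S, h⟩ := h
  rw [isRejectiveChain_iff] at h
  have hprod : ∀ i ≤ n, ∀ X Y : ModCat A, S i X → S i Y →
      S i (FGModuleCat.of Aᵐᵒᵖ (X × Y)) := by
    intro i hi X Y hX hY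
    let b : Limits.BinaryBicone X Y :=
      { pt := FGModuleCat.of Aᵐᵒᵖ (X × Y)
        fst := ModCat.ofLin (LinearMap.fst _ _ _)
        snd := ModCat.ofLin (LinearMap.snd _ _ _)
        inl := ModCat.ofLin (LinearMap.inl _ _ _)
        inr := ModCat.ofLin (LinearMap.inr _ _ _)
        inl_fst := ModCat.ext_lin fun _ => rfl
        inl_snd := ModCat.ext_lin fun _ => rfl
        inr_fst := ModCat.ext_lin fun _ => rfl
        inr_snd := ModCat.ext_lin fun _ => rfl }
    refine ((h.additive i hi).sum_iff b ⟨Limits.isBinaryBilimitOfTotal b ?_⟩).2 ⟨hX, hY⟩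
    refine ModCat.ext_lin fun x => ?_
    change ((x.1, 0) + (0, x.2) : X × Y) = x
    simp
  have hfactor : ∀ i < n, ∀ (X Y : ModCat A), S i X → S i Y → ∀ f : X ⟶ Y,
      (∀ g : Y →ₗ[Aᵐᵒᵖ] X, IsUnit (1 - g ∘ₗ ModCat.toLin f : Module.End Aᵐᵒᵖ X)) →
      FactorsThrough (S (i + 1)) f := fun i hi X Y hX hY f hf =>
    h.cosemisimple i hi X Y hX hY f (inRadicalMod_of_isUnit (h.additive (i + 1) hi) f hf)
  have hquot : ∀ i < n, ∀ (X : Type u) [AddCommGroup X] [Module Aᵐᵒᵖ X] [Module.Finite Aᵐᵒᵖ X],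
      IsIndecomposable A X → S i (FGModuleCat.of Aᵐᵒᵖ X) → ∀ U : Submodule Aᵐᵒᵖ X, U ≠ ⊥ →
      S (i + 1) (FGModuleCat.of Aᵐᵒᵖ (X ⧸ U)) := by
    intro i hi X _ _ _ hX hS U hU
    have hS' : S i (FGModuleCat.of Aᵐᵒᵖ (X ⧸ U)) :=
      (h.closed i hi.le).2 (FGModuleCat.ofHom U.mkQ) U.mkQ_surjective hS
    obtain ⟨Z, hZ, a, b, hab⟩ := hfactor i hi _ _ hS hS' (FGModuleCat.ofHom U.mkQ) fun g => by
      refine hX.isUnit_one_sub fun hu => hU ?_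
      have hinj : Function.Injective (g ∘ₗ U.mkQ) := ((Module.End.isUnit_iff _).1 hu).1
      rw [eq_bot_iff]
      intro x hx
      refine hinj ?_
      simp [(Submodule.Quotient.mk_eq_zero U).2 hx]
    refine (h.closed (i + 1) hi).2 b (fun y => ?_) hZ
    obtain ⟨x, rfl⟩ := U.mkQ_surjective y
    exact ⟨ModCat.toLin a x, congrArg (fun k => ModCat.toLin k x) hab⟩
  have hsub : ∀ i < n, ∀ (X : Type u) [AddCommGroup X] [Module Aᵐᵒᵖ X] [Module.Finite Aᵐᵒᵖ X],
      IsIndecomposable A X → S i (FGModuleCat.of Aᵐᵒᵖ X) → ∀ U : Submodule Aᵐᵒᵖ X, U ≠ ⊤ →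
      S (i + 1) (FGModuleCat.of Aᵐᵒᵖ U) := by
    intro i hi X _ _ _ hX hS U hU
    have hS' : S i (FGModuleCat.of Aᵐᵒᵖ U) :=
      (h.closed i hi.le).1 (FGModuleCat.ofHom U.subtype) U.injective_subtype hS
    obtain ⟨Z, hZ, a, b, hab⟩ := hfactor i hi _ _ hS' hS (FGModuleCat.ofHom U.subtype) fun g => by
      refine isUnit_one_sub_comp_comm g U.subtype (hX.isUnit_one_sub fun hu => hU ?_)
      rw [eq_top_iff]
      intro x _
      obtain ⟨y, rfl⟩ := ((Module.End.isUnit_iff _).1 hu).2 x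
      exact (g y).2
    refine (h.closed (i + 1) hi).1 a (fun x y hxy => ?_) hZ
    have key : ∀ x : U, ModCat.toLin b (ModCat.toLin a x) = (x : X) := fun x =>
      congrArg (fun k => ModCat.toLin k x) hab
    apply Subtype.ext
    rw [← key x, ← key y, hxy]
  refine isNakayama_of_filtration n
    (fun i X _ _ => ∃ _ : Module.Finite Aᵐᵒᵖ X, S i (FGModuleCat.of Aᵐᵒᵖ X)) ?_ ?_ ?_ ?_ ?_
  · intro X _ _ hX
    exact ⟨hX, by rw [h.zero]; trivial⟩
  · rintro X _ _ _ ⟨_, hX⟩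
    exact (ModCat.isZero_iff _).1 ((h.last _).1 hX)
  -- `X` embeds in `X / U × X / V`; in the next case `U × V` maps onto `X`.
  · rintro i hi X _ _ hX' hX ⟨_, hS⟩ U V hU hV hUV
    refine ⟨hX', (h.closed (i + 1) hi).1 (Y := FGModuleCat.of Aᵐᵒᵖ ((X ⧸ U) × (X ⧸ V)))
      (FGModuleCat.ofHom (U.mkQ.prod V.mkQ)) ?_ (hprod (i + 1) hi _ _
        (hquot i hi X hX hS U hU) (hquot i hi X hX hS V hV))⟩
    change Function.Injective (U.mkQ.prod V.mkQ)
    rw [← LinearMap.ker_eq_bot, LinearMap.ker_prod, Submodule.ker_mkQ, Submodule.ker_mkQ, hUV]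
  · rintro i hi X _ _ hX' hX ⟨_, hS⟩ U V hU hV hUV
    refine ⟨hX', (h.closed (i + 1) hi).2 (X := FGModuleCat.of Aᵐᵒᵖ (U × V))
      (FGModuleCat.ofHom (U.subtype.coprod V.subtype)) ?_ (hprod (i + 1) hi _ _
        (hsub i hi X hX hS U hU) (hsub i hi X hX hS V hV))⟩
    change Function.Surjective (U.subtype.coprod V.subtype)
    rw [← LinearMap.range_eq_top, LinearMap.range_coprod, Submodule.range_subtype,
      Submodule.range_subtype, hUV]
  · rintro i hi X _ _ hX' hX ⟨_, hS⟩ U hU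
    exact ⟨inferInstance, hsub i hi X hX hS U hU⟩

end ModCatChains
-- The equivalence `Hom(M, -)` between `mod A` and `proj (End M)`
theorem finite_of_dualBasis {S P : Type*} [Ring S] [AddCommGroup P] [Module S P] {n : ℕ}
    (u : Fin n → P) (φ : Fin n → P →ₗ[S] S) (h : ∀ x, ∑ j, φ j x • u j = x) :
    Module.Finite S P :=
  Module.Finite.of_surjective (Fintype.linearCombination S u) fun x =>
    ⟨fun j => φ j x, by simpa [Fintype.linearCombination_apply] using h x⟩

section HomFunctor

variable {A : Type u} [Ring A] {M : Type u} [AddCommGroup M] [Module Aᵐᵒᵖ M]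

variable (A M) in
/-- The group of maps `M → N`, on which `End M` acts from the right by composition. -/
def HomFrom (N : Type u) [AddCommGroup N] [Module Aᵐᵒᵖ N] : Type u :=
  M →ₗ[Aᵐᵒᵖ] N

instance (N : Type u) [AddCommGroup N] [Module Aᵐᵒᵖ N] : AddCommGroup (HomFrom A M N) :=
  inferInstanceAs (AddCommGroup (M →ₗ[Aᵐᵒᵖ] N))

/-- A map `M → N`, as an element of `HomFrom A M N`. -/
def HomFrom.equiv {N : Type u} [AddCommGroup N] [Module Aᵐᵒᵖ N] :
    (M →ₗ[Aᵐᵒᵖ] N) ≃+ HomFrom A M N :=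
  AddEquiv.refl _

instance (N : Type u) [AddCommGroup N] [Module Aᵐᵒᵖ N] :
    Module (AuslanderAlgebra A M)ᵐᵒᵖ (HomFrom A M N) where
  smul b f := LinearMap.comp (f : M →ₗ[Aᵐᵒᵖ] N) (b.unop : M →ₗ[Aᵐᵒᵖ] M)
  one_smul _ := rfl
  mul_smul _ _ _ := rfl
  smul_zero _ := LinearMap.zero_comp _
  zero_smul _ := LinearMap.comp_zero _
  smul_add _ _ _ := LinearMap.add_comp _ _ _
  add_smul _ _ _ := LinearMap.comp_add _ _ _

variable (M) in
/-- Composition with `f`, as a map of right `End M`-modules. -/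
def homFromMap {N N' : Type u} [AddCommGroup N] [Module Aᵐᵒᵖ N] [AddCommGroup N'] [Module Aᵐᵒᵖ N']
    (f : N →ₗ[Aᵐᵒᵖ] N') : HomFrom A M N →ₗ[(AuslanderAlgebra A M)ᵐᵒᵖ] HomFrom A M N' where
  toFun g := f ∘ₗ (g : M →ₗ[Aᵐᵒᵖ] N)
  map_add' _ _ := LinearMap.comp_add _ _ _
  map_smul' _ _ := rfl

theorem HomFrom.equiv_symm_sum_apply {N : Type u} [AddCommGroup N] [Module Aᵐᵒᵖ N] {ι : Type*}
    (s : Finset ι) (f : ι → HomFrom A M N) (m : M) :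
    HomFrom.equiv.symm (∑ j ∈ s, f j) m = ∑ j ∈ s, HomFrom.equiv.symm (f j) m := by
  rw [map_sum, LinearMap.sum_apply]

theorem IsAdditiveGenerator.finite_projective_homFrom (hM : IsAdditiveGenerator A M) (N : Type u)
    [AddCommGroup N] [Module Aᵐᵒᵖ N] [Module.Finite Aᵐᵒᵖ N] :
    Module.Finite (AuslanderAlgebra A M)ᵐᵒᵖ (HomFrom A M N) ∧
      Module.Projective (AuslanderAlgebra A M)ᵐᵒᵖ (HomFrom A M N) := by
  obtain ⟨k, s, r, hsr⟩ := hM.exists_sum_eq N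
  let φ : Fin k → HomFrom A M N →ₗ[(AuslanderAlgebra A M)ᵐᵒᵖ] (AuslanderAlgebra A M)ᵐᵒᵖ := fun j =>
    { toFun := fun f => MulOpposite.op (s j ∘ₗ (f : M →ₗ[Aᵐᵒᵖ] N))
      map_add' := fun f g => MulOpposite.unop_injective (LinearMap.comp_add _ _ _)
      map_smul' := fun b f => rfl }
  have h : ∀ f : HomFrom A M N, ∑ j, φ j f • HomFrom.equiv (r j) = f := by
    intro f
    refine HomFrom.equiv.symm.injective (LinearMap.ext fun m => ?_)
    rw [HomFrom.equiv_symm_sum_apply]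
    exact hsr (HomFrom.equiv.symm f m)
  exact ⟨finite_of_dualBasis _ φ h, projective_of_dualBasis _ φ h⟩

/-- The functor `Hom(M, -)` from `mod A` to `proj (End M)`. -/
def homFunctor (hM : IsAdditiveGenerator A M) : ModCat A ⥤ ProjCat (AuslanderAlgebra A M) where
  obj N := ⟨ModuleCat.of _ (HomFrom A M N), hM.finite_projective_homFrom N⟩
  map f := ObjectProperty.homMk (ModuleCat.ofHom (homFromMap M (ModCat.toLin f)))

/-- The linear map underlying a morphism of `proj B`. -/
abbrev ProjCat.toLin {B : Type u} [Ring B] {P Q : ProjCat B} (f : P ⟶ Q) :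
    P.obj →ₗ[Bᵐᵒᵖ] Q.obj := f.hom.hom

theorem ProjCat.ext_lin {B : Type u} [Ring B] {P Q : ProjCat B} {f g : P ⟶ Q}
    (h : ∀ x : P.obj, ProjCat.toLin f x = ProjCat.toLin g x) : f = g :=
  ObjectProperty.hom_ext _ (ModuleCat.hom_ext (LinearMap.ext h))

variable (hM : IsAdditiveGenerator A M)

instance : (homFunctor hM).Additive where
  map_add {_ _ f g} := ProjCat.ext_lin fun x =>
    LinearMap.add_comp (HomFrom.equiv.symm x) (ModCat.toLin g) (ModCat.toLin f)

instance : (homFunctor hM).Faithful where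
  map_injective {X Y f g} h := by
    refine ModCat.ext_lin fun x => ?_
    refine hM.mem_of_forall (P := LinearMap.eqLocus (ModCat.toLin f) (ModCat.toLin g))
      (fun a m => ?_) x
    have : ModCat.toLin f ∘ₗ a = ModCat.toLin g ∘ₗ a :=
      congrArg (fun k => ProjCat.toLin k (HomFrom.equiv a)) h
    exact LinearMap.congr_fun this m

/-- From `a = ∑ r j ∘ (s j ∘ a)` and linearity, `φ a = ∑ φ (r j) ∘ s j ∘ a`, so `φ` is composition
with `∑ φ (r j) ∘ s j`. -/
theorem IsAdditiveGenerator.exists_eq_homFromMap (hM : IsAdditiveGenerator A M) {N N' : Type u}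
    [AddCommGroup N] [Module Aᵐᵒᵖ N] [Module.Finite Aᵐᵒᵖ N] [AddCommGroup N'] [Module Aᵐᵒᵖ N']
    (φ : HomFrom A M N →ₗ[(AuslanderAlgebra A M)ᵐᵒᵖ] HomFrom A M N') :
    ∃ f : N →ₗ[Aᵐᵒᵖ] N', homFromMap M f = φ := by
  obtain ⟨k, s, r, hsr⟩ := hM.exists_sum_eq N
  refine ⟨∑ j, HomFrom.equiv.symm (φ (HomFrom.equiv (r j))) ∘ₗ s j, LinearMap.ext fun a => ?_⟩
  have ha : a = ∑ j, (MulOpposite.op (s j ∘ₗ HomFrom.equiv.symm a) : (AuslanderAlgebra A M)ᵐᵒᵖ) •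
      HomFrom.equiv (r j) := by
    refine HomFrom.equiv.symm.injective (LinearMap.ext fun m => ?_)
    rw [HomFrom.equiv_symm_sum_apply]
    exact (hsr (HomFrom.equiv.symm a m)).symm
  conv_rhs => rw [ha, map_sum]
  simp only [map_smul]
  refine HomFrom.equiv.symm.injective (LinearMap.ext fun m => ?_)
  rw [HomFrom.equiv_symm_sum_apply]
  exact LinearMap.sum_apply _ _ _

instance : (homFunctor hM).Full where
  map_surjective {X Y} φ := by
    obtain ⟨f, hf⟩ := hM.exists_eq_homFromMap (N := X) (N' := Y) (ProjCat.toLin φ)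
    exact ⟨ModCat.ofLin f, ProjCat.ext_lin fun x => LinearMap.congr_fun hf x⟩

theorem ModCat.exists_splitting [IsArtinianRing Aᵐᵒᵖ] {X : ModCat A} (e : X ⟶ X) (he : e ≫ e = e) :
    ∃ (Y : ModCat A) (i : Y ⟶ X) (p : X ⟶ Y), i ≫ p = 𝟙 Y ∧ p ≫ i = e := by
  refine ⟨FGModuleCat.of Aᵐᵒᵖ (LinearMap.range (ModCat.toLin e)),
    ModCat.ofLin (LinearMap.range (ModCat.toLin e)).subtype,
    ModCat.ofLin (ModCat.toLin e).rangeRestrict, ModCat.ext_lin ?_, ModCat.ext_lin fun x => rfl⟩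
  rintro ⟨_, x, rfl⟩
  exact Subtype.ext (congrArg (fun k => ModCat.toLin k x) he)

/-- A finitely generated projective module is a summand of a free one, here `Hom(M, M ^ n)`. Its
idempotent lifts by fullness and splits in `mod A`. -/
theorem essSurj_homFunctor [IsArtinianRing Aᵐᵒᵖ] : (homFunctor hM).EssSurj where
  mem_essImage P := by
    let B := AuslanderAlgebra A M
    have := hM.finite
    have := P.property.1
    have := P.property.2
    obtain ⟨n, π, hπ⟩ := Module.Finite.exists_fin' Bᵐᵒᵖ P.obj
    obtain ⟨σ, hσ⟩ := Module.projective_lifting_property π LinearMap.id hπ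
    let X : ModCat A := FGModuleCat.of Aᵐᵒᵖ (Fin n → M)
    let θ : HomFrom A M (Fin n → M) →ₗ[Bᵐᵒᵖ] (Fin n → Bᵐᵒᵖ) :=
      LinearMap.pi fun j =>
        { toFun := fun f => MulOpposite.op (LinearMap.proj j ∘ₗ (f : M →ₗ[Aᵐᵒᵖ] (Fin n → M)))
          map_add' := fun f g => MulOpposite.unop_injective (LinearMap.comp_add _ _ _)
          map_smul' := fun b f => rfl }
    let θ' : (Fin n → Bᵐᵒᵖ) →ₗ[Bᵐᵒᵖ] HomFrom A M (Fin n → M) :=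
      { toFun := fun v => LinearMap.pi fun j => ((v j).unop : M →ₗ[Aᵐᵒᵖ] M)
        map_add' := fun v w => rfl
        map_smul' := fun b v => rfl }
    let i : P ⟶ (homFunctor hM).obj X := ObjectProperty.homMk (ModuleCat.ofHom (θ' ∘ₗ σ))
    let r : (homFunctor hM).obj X ⟶ P := ObjectProperty.homMk (ModuleCat.ofHom (π ∘ₗ θ))
    have hir : i ≫ r = 𝟙 P := ProjCat.ext_lin fun x => LinearMap.congr_fun hσ x
    obtain ⟨Y, i', r', h1, h2⟩ := ModCat.exists_splitting ((homFunctor hM).preimage (r ≫ i))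
      ((homFunctor hM).map_injective (by simp [reassoc_of% hir]))
    have h1' := congrArg (homFunctor hM).map h1
    have h2' := congrArg (homFunctor hM).map h2
    rw [CategoryTheory.Functor.map_comp, CategoryTheory.Functor.map_id] at h1'
    rw [CategoryTheory.Functor.map_comp, Functor.map_preimage] at h2'
    refine ⟨Y, ⟨⟨(homFunctor hM).map i' ≫ r, i ≫ (homFunctor hM).map r', ?_, ?_⟩⟩⟩
    · rw [Category.assoc, ← Category.assoc r, ← h2', Category.assoc, reassoc_of% h1', h1']
    · rw [Category.assoc, reassoc_of% h2', hir, Category.comp_id, hir]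

theorem hasRejectiveChain_projCat_iff [IsArtinianRing Aᵐᵒᵖ] (hM : IsAdditiveGenerator A M) :
    HasRejectiveChain (ProjCat (AuslanderAlgebra A M)) ↔ HasRejectiveChain (ModCat A) := by
  have := essSurj_homFunctor hM
  have : (homFunctor hM).IsEquivalence := {}
  have : (homFunctor hM).asEquivalence.functor.Additive := inferInstanceAs (homFunctor hM).Additive
  have := (homFunctor hM).asEquivalence.inverse_additive
  refine ⟨HasRejectiveChain.of_isEquivalence (homFunctor hM), fun h => ?_⟩
  exact HasRejectiveChain.of_isEquivalence (homFunctor hM).asEquivalence.inverse h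

end HomFunctor

end StronglyQH

theorem theorem1p4 {R : Type*} [CommRing R] [IsArtinianRing R]
    (A : Type u) [Ring A] [Algebra R A] [Module.Finite R A]
    (hA : StronglyQH.IsRepresentationFinite A)
    (M : Type u) [AddCommGroup M] [Module Aᵐᵒᵖ M] (hM : StronglyQH.IsAdditiveGenerator A M) :
    List.TFAE [
      StronglyQH.IsStronglyQuasiHereditary (StronglyQH.AuslanderAlgebra A M),
      StronglyQH.HasRejectiveChain (StronglyQH.ProjCat (StronglyQH.AuslanderAlgebra A M)),
      StronglyQH.HasRejectiveChain (StronglyQH.ModCat A),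
      StronglyQH.IsNakayama A] := by
  -- The base ring serves only to make `Aᵐᵒᵖ` artinian.
  have : Module.Finite R Aᵐᵒᵖ := Module.Finite.equiv (MulOpposite.opLinearEquiv R)
  have : IsArtinianRing Aᵐᵒᵖ := isArtinian_of_tower R inferInstance
  tfae_have 1 → 4 := StronglyQH.isNakayama_of_isStronglyQuasiHereditary hM
  tfae_have 4 → 1 := fun h => h.isStronglyQuasiHereditary hM
  tfae_have 2 ↔ 3 := StronglyQH.hasRejectiveChain_projCat_iff hM
  tfae_have 3 → 4 := StronglyQH.isNakayama_of_hasRejectiveChain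
  tfae_have 4 → 3 := fun h => h.hasRejectiveChain
  tfae_finish
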